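/- **Notation.** Let $0<\beta-\alpha<\pi$. A matrix $C\in\mathbb C^{n\times n}$ is semisectorial if $0$ is not an interior point of its numerical range $\{x^*Cx: x^*x=1\}$. Such a matrix is congruent to a canonical form, $C=T\big(0_k\oplus\mathrm{diag}(e^{i\alpha_1},\dots,e^{i\alpha_l})\oplus\bigoplus_{j=1}^m e^{i\gamma}\begin{bmatrix}1&2\\0&1\end{bmatrix}\big)T^*$ with $T$ nonsingular; its phases are $\alpha_1,\dots,\alpha_l$ and $m$ copies of each of $\gamma\pm\frac{\pi}{2}$, chosen in a closed interval of length $\pi$. Let $\mathcal C[\alpha,\beta]$ be the set of semisectorial matrices whose phases can be chosen in $[\alpha,\beta]$ (the zero matrix included). Let $\mathcal G$ be an undirected graph on $\{1,\dots,n\}$ with a self-loop at every vertex and edge set $\mathcal E$, and assume that it is banded: if $\{i_0,j_0\}\in\mathcal E$ and $i_0\le i<j\le j_0$, then $\{i,j\}\in\mathcal E$. (Such a graph is chordal.) A partial matrix $C$ with pattern $\mathcal G$ has the entries $C_{ij}$, $\{i,j\}\in\mathcal E$, specified and all others free. Put, on the pattern, $H(C)=\frac12(C+C^*)$, $S(C)=\frac1{2i}(C-C^*)$,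 $$H_\alpha(C)=-\sin\alpha\,H(C)+\cos\alpha\,S(C),\qquad S_\beta(C)=\sin\beta\,H(C)-\cos\beta\,S(C).$$ The central completion $P_c$ of a partial matrix $P$ with pattern $\mathcal G$ is computed as follows. Let $J(i)=\max\{j:\{i,j\}\in\mathcal E\}$. For $i=2,\dots,n$ in turn, whenever $J(i)>J(i-1)$, put $X=\{1,\dots,i-1\}$, $Y=\{i,\dots,J(i-1)\}$, $Z=\{J(i-1)+1,\dots,J(i)\}$ and fill in $P[X,Z]=P[X,Y]\,P[Y]^{+}\,P[Y,Z]$ and $P[Z,X]=P[X,Z]^*$, where $^+$ is the Moore–Penrose inverse and the product is $0$ if $Y=\emptyset$. An upper (lower) Cholesky factor of a positive semidefinite matrix $K$ is an upper triangular $R$ (lower triangular $L$) with $K=R^*R$ ($K=L^*L$) in which every row with zero diagonal entry is zero. For such $R,L$ let $\mathbf\Gamma_{\mathcal G}(R,L)$ be the set of upper triangular $\Gamma\in\mathbb C^{n\times n}$ with $\Gamma_{ij}=0$ for $\{i,j\}\in\mathcal E$, spectral norm $\|\Gamma\|_2\le1$, $\Gamma x=0$ for all $x\in(\operatorname{ran}R)^\perp$,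 and $\operatorname{ran}\Gamma\perp(\operatorname{ran}L)^\perp$. For a unitary $W$ with $R=WL$ put $$f_{R,W}(\Gamma)=R^*(I+W\Gamma)^{-*}(I-\Gamma^*\Gamma)(I+W\Gamma)^{-1}R .$$ **Theorem.** Let $0<\beta-\alpha<\pi$, let $\mathcal G$ be banded, and let $C$ be a partial matrix with pattern $\mathcal G$ such that $C[\mathcal K]\in\mathcal C[\alpha,\beta]$ for every clique $\mathcal K$ of $\mathcal G$. Then: 1. The set $\mathcal S$ of all completions of $C$ that lie in $\mathcal C[\alpha,\beta]$ is nonempty. 2. The central completions $H_\alpha(C)_c$ and $S_\beta(C)_c$ each have an upper and a lower Cholesky factor, and for any upper factor $R$ and lower factor $L$ of the same one of these matrices there is a unitary $W$ with $R=WL$. 3. Let $R_1,L_1$ be an upper and a lower Cholesky factor of $H_\alpha(C)_c$ and $R_2,L_2$ of $S_\beta(C)_c$, and let $W_1,W_2$ be unitary with $R_j=W_jL_j$. Then $I+W_j\Gamma$ is invertible for every $\Gamma\in\mathbf\Gamma_{\mathcal G}(R_j,L_j)$ $(j=1,2)$, and $$(\Gamma_1,\Gamma_2)\longmapsto\frac{1}{\sin(\beta-\alpha)}\Big(e^{i\beta}f_{R_1,W_1}(\Gamma_1)+e^{i\alpha}f_{R_2,W_2}(\Gamma_2)\Big)$$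 is a bijection from $\mathbf\Gamma_{\mathcal G}(R_1,L_1)\times\mathbf\Gamma_{\mathcal G}(R_2,L_2)$ onto $\mathcal S$. -/

import Mathlib

open scoped Matrix

namespace PhaseCompletion

/-! ### Numerical range, phases, phase-bounded cones -/

section Phases

variable {ι : Type*} [Fintype ι] [DecidableEq ι]

/-- The numerical range `{x* C x | x* x = 1}`. -/
def numericalRange (C : Matrix ι ι ℂ) : Set ℂ :=
  {z | ∃ x : ι → ℂ, star x ⬝ᵥ x = 1 ∧ z = star x ⬝ᵥ (C *ᵥ x)}

/-- `C` is semisectorial: the origin is not interior to its numerical range. -/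
def IsSemisectorial (C : Matrix ι ι ℂ) : Prop :=
  (0 : ℂ) ∉ interior (numericalRange C)

/-- The congruence canonical form
`0_k ⊕ diag(e^{i a_1}, …, e^{i a_l}) ⊕ (m copies of e^{iγ} [1 2; 0 1])`. -/
noncomputable def canonicalForm (k l m : ℕ) (a : Fin l → ℝ) (γ : ℝ) :
    Matrix (Fin k ⊕ Fin l ⊕ (Fin 2 × Fin m)) (Fin k ⊕ Fin l ⊕ (Fin 2 × Fin m)) ℂ :=
  Matrix.fromBlocks 0 0 0
    (Matrix.fromBlocks
      (Matrix.diagonal fun j => Complex.exp (Complex.I * (a j : ℂ))) 0 0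
      (Matrix.blockDiagonal fun _ : Fin m =>
        Complex.exp (Complex.I * (γ : ℂ)) • !![(1 : ℂ), 2; 0, 1]))

/-- `φ` is a set of phases of the semisectorial matrix `C`: `C = T D T*` with `T`
nonsingular and `D` a canonical form (up to reordering the index set) with parameters `a_j, γ`, and `φ` consists of the `a_j` and
of `m` copies of each of `γ - π/2`, `γ + π/2`, all lying in one closed interval of length `π`. -/
def IsPhases (C : Matrix ι ι ℂ) (φ : Multiset ℝ) : Prop :=
  IsSemisectorial C ∧
  ∃ (k l m : ℕ) (a : Fin l → ℝ) (γ : ℝ)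
    (e : (Fin k ⊕ Fin l ⊕ (Fin 2 × Fin m)) ≃ ι) (T : Matrix ι ι ℂ),
    IsUnit T ∧
    C = T * Matrix.reindex e e (canonicalForm k l m a γ) * Tᴴ ∧
    φ = Multiset.map a Finset.univ.val
        + Multiset.replicate m (γ - Real.pi / 2) + Multiset.replicate m (γ + Real.pi / 2) ∧
    ∃ θ : ℝ, ∀ t ∈ φ, θ ≤ t ∧ t ≤ θ + Real.pi

/-- The cone `C[α, β]` of semisectorial matrices with phases in `[α, β]`
(the zero matrix has no phases and belongs to the cone). -/
def phaseBoundedCone (α β : ℝ) : Set (Matrix ι ι ℂ) :=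
  {C | ∃ φ : Multiset ℝ, IsPhases C φ ∧ ∀ t ∈ φ, α ≤ t ∧ t ≤ β}

end Phases

/-! ### Moore-Penrose inverse -/

section PseudoInverse

variable {ι : Type*} [Fintype ι] [DecidableEq ι]

/-- The four Penrose equations. -/
def IsMoorePenrose (A B : Matrix ι ι ℂ) : Prop :=
  A * B * A = A ∧ B * A * B = B ∧ (A * B)ᴴ = A * B ∧ (B * A)ᴴ = B * A

theorem exists_hermitian_pinv (S : Matrix ι ι ℂ) (hS : S.IsHermitian) :
    ∃ P : Matrix ι ι ℂ, Pᴴ = P ∧ S * P * S = S ∧ P * S * P = P ∧ P * S = S * P := by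
  have hu : (hS.eigenvectorUnitary : Matrix ι ι ℂ)ᴴ * (hS.eigenvectorUnitary : Matrix ι ι ℂ) = 1 :=
    Unitary.coe_star_mul_self hS.eigenvectorUnitary
  have hs := hS.spectral_theorem
  rw [Unitary.conjStarAlgAut_apply] at hs
  change S = (hS.eigenvectorUnitary : Matrix ι ι ℂ) * _
    * (hS.eigenvectorUnitary : Matrix ι ι ℂ)ᴴ at hs
  generalize (hS.eigenvectorUnitary : Matrix ι ι ℂ) = U at hu hs
  generalize hS.eigenvalues = d at hs
  set D : Matrix ι ι ℂ := Matrix.diagonal (RCLike.ofReal ∘ d) with hD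
  set E : Matrix ι ι ℂ := Matrix.diagonal (fun i => ((d i : ℂ))⁻¹) with hE
  have key : ∀ X Y : Matrix ι ι ℂ, (U * X * Uᴴ) * (U * Y * Uᴴ) = U * (X * Y) * Uᴴ := by
    intro X Y
    calc (U * X * Uᴴ) * (U * Y * Uᴴ) = U * X * (Uᴴ * U) * Y * Uᴴ := by
          simp only [Matrix.mul_assoc]
      _ = _ := by rw [hu]; simp only [Matrix.mul_assoc, Matrix.mul_one]
  have hcomm : E * D = D * E := by
    simp only [hD, hE, Matrix.diagonal_mul_diagonal]
    congr 1; funext i; ring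
  have h1 : D * E * D = D := by
    simp only [hD, hE, Matrix.diagonal_mul_diagonal]
    congr 1; funext i
    by_cases h : (d i : ℂ) = 0
    · simp [h]
    · simp [h]
  have h2 : E * D * E = E := by
    simp only [hD, hE, Matrix.diagonal_mul_diagonal]
    congr 1; funext i
    by_cases h : (d i : ℂ) = 0
    · simp [h]
    · simp [h]
  have h3 : Eᴴ = E := by
    rw [hE, Matrix.diagonal_conjTranspose]
    congr 1; funext i; simp
  refine ⟨U * E * Uᴴ, ?_, ?_, ?_, ?_⟩
  · simp only [Matrix.conjTranspose_mul, Matrix.conjTranspose_conjTranspose, h3, Matrix.mul_assoc]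
  · rw [hs, key, key, h1]
  · rw [hs, key, key, h2]
  · rw [hs, key, key, hcomm]

open scoped ComplexOrder in
theorem exists_isMoorePenrose (A : Matrix ι ι ℂ) : ∃ B, IsMoorePenrose A B := by
  obtain ⟨P, hP, h1, h2, h3⟩ :=
    exists_hermitian_pinv (Aᴴ * A) (Matrix.isHermitian_conjTranspose_mul_self A)
  have hz : A * P * (Aᴴ * A) = A := by
    have h0 : (A * P * (Aᴴ * A) - A)ᴴ * (A * P * (Aᴴ * A) - A) = 0 := by
      have e1 : (A * P * (Aᴴ * A) - A)ᴴ * (A * P * (Aᴴ * A) - A)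
          = ((Aᴴ * A) * P * (Aᴴ * A)) * P * (Aᴴ * A) - (Aᴴ * A) * P * (Aᴴ * A)
            - ((Aᴴ * A) * P * (Aᴴ * A) - Aᴴ * A) := by
        simp only [Matrix.conjTranspose_sub, Matrix.conjTranspose_mul,
          Matrix.conjTranspose_conjTranspose, hP, Matrix.sub_mul, Matrix.mul_sub, Matrix.mul_assoc]
      rw [e1]; simp only [h1, sub_self]
    exact sub_eq_zero.mp (Matrix.conjTranspose_mul_self_eq_zero.mp h0)
  refine ⟨P * Aᴴ, ?_, ?_, ?_, ?_⟩
  · rw [← Matrix.mul_assoc, Matrix.mul_assoc]; exact hz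
  · calc P * Aᴴ * A * (P * Aᴴ) = (P * (Aᴴ * A) * P) * Aᴴ := by simp only [Matrix.mul_assoc]
      _ = _ := by rw [h2]
  · simp only [Matrix.conjTranspose_mul, Matrix.conjTranspose_conjTranspose, hP, Matrix.mul_assoc]
  · rw [Matrix.mul_assoc, Matrix.conjTranspose_mul, Matrix.conjTranspose_mul,
      Matrix.conjTranspose_conjTranspose, hP]
    exact h3.symm

/-- The Moore-Penrose inverse. -/
noncomputable def pinv (A : Matrix ι ι ℂ) : Matrix ι ι ℂ :=
  Classical.choose (exists_isMoorePenrose A)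

theorem pinv_spec (A : Matrix ι ι ℂ) : IsMoorePenrose A (pinv A) :=
  Classical.choose_spec (exists_isMoorePenrose A)

end PseudoInverse

/-! ### Patterns and partial matrices -/

section Partial

variable {n : ℕ}

/-- Position `(i, j)` belongs to the pattern; every vertex carries a self-loop. -/
def InPattern (G : SimpleGraph (Fin n)) (i j : Fin n) : Prop := i = j ∨ G.Adj i j

theorem InPattern.symm {G : SimpleGraph (Fin n)} {i j : Fin n} (h : InPattern G i j) :
    InPattern G j i :=
  h.elim (fun h => Or.inl h.symm) (fun h => Or.inr h.symm)

/-- The graph is banded (with respect to the natural order of the vertices). -/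
def IsBanded (G : SimpleGraph (Fin n)) : Prop :=
  ∀ i₀ j₀ : Fin n, i₀ < j₀ → G.Adj i₀ j₀ →
    ∀ i j : Fin n, i₀ ≤ i → i < j → j ≤ j₀ → G.Adj i j

/-- A partial matrix with pattern `G`: only the entries in the pattern are given. -/
abbrev PartialMatrix (G : SimpleGraph (Fin n)) : Type :=
  {p : Fin n × Fin n // InPattern G p.1 p.2} → ℂ

variable {G : SimpleGraph (Fin n)}

/-- `K` is a completion of the partial matrix `C`. -/
def IsCompletion (C : PartialMatrix G) (K : Matrix (Fin n) (Fin n) ℂ) : Prop :=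
  ∀ p, K p.1.1 p.1.2 = C p

/-- The specified principal submatrix `C[s]` of a partial matrix for a clique `s`. -/
def cliqueSubmatrix (C : PartialMatrix G) (s : Finset (Fin n)) (hs : G.IsClique (s : Set (Fin n))) :
    Matrix s s ℂ :=
  fun i j => C ⟨(i.1, j.1), (eq_or_ne i.1 j.1).imp id (fun h => hs i.2 j.2 h)⟩

/-- All specified clique submatrices of `C` are in `C[α, β]`. -/
def IsPartiallyPhaseBounded (α β : ℝ) (C : PartialMatrix G) : Prop :=
  ∀ (s : Finset (Fin n)) (hs : G.IsClique (s : Set (Fin n))),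
    cliqueSubmatrix C s hs ∈ phaseBoundedCone α β

/-- The set of all completions of `C` in `C[α, β]`. -/
def completionSet (α β : ℝ) (C : PartialMatrix G) : Set (Matrix (Fin n) (Fin n) ℂ) :=
  {K | K ∈ phaseBoundedCone α β ∧ IsCompletion C K}

/-- The conjugate transpose of a partial matrix. -/
noncomputable def partialConjTranspose (C : PartialMatrix G) : PartialMatrix G :=
  fun p => star (C ⟨(p.1.2, p.1.1), p.2.symm⟩)

/-- `H(C) = (C + C*) / 2`. -/
noncomputable def hermPart (C : PartialMatrix G) : PartialMatrix G :=
  fun p => (C p + partialConjTranspose C p) / 2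

/-- `S(C) = (C - C*) / (2 i)`. -/
noncomputable def skewPart (C : PartialMatrix G) : PartialMatrix G :=
  fun p => (C p - partialConjTranspose C p) / (2 * Complex.I)

/-- `H_α(C) = - sin α H(C) + cos α S(C)`. -/
noncomputable def hermRot (α : ℝ) (C : PartialMatrix G) : PartialMatrix G :=
  fun p => -(Real.sin α : ℂ) * hermPart C p + (Real.cos α : ℂ) * skewPart C p

/-- `S_β(C) = sin β H(C) - cos β S(C)`. -/
noncomputable def skewRot (β : ℝ) (C : PartialMatrix G) : PartialMatrix G :=
  fun p => (Real.sin β : ℂ) * hermPart C p - (Real.cos β : ℂ) * skewPart C p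

/-! ### The central completion

Vertices are labelled `1, …, n`: the label of `v : Fin n` is `v.val + 1`. -/

open Classical in
/-- `J(i) = max {j | {i, j} ∈ E}` for the label `1 ≤ i ≤ n`, and `J(0) = 0`. -/
noncomputable def lastNeighbor (G : SimpleGraph (Fin n)) (i : ℕ) : ℕ :=
  (Finset.univ.filter fun j : Fin n => ∃ v : Fin n, v.val + 1 = i ∧ InPattern G v j).sup
    fun j => j.val + 1

open Classical in
/-- One staircase step: with `X = {1, …, x-1}`, `Y = {x, …, y}`, `Z = {y+1, …, z}`, the block
`M[X, Z]` is replaced by `M[X, Y] M[Y]⁺ M[Y, Z]` (which is zero if `Y` is empty) and `M[Z, X]` by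
its conjugate transpose. (The product `T` is formed for all rows and columns, but it is only read
off on `X × Z`.) -/
noncomputable def staircaseFill (x y z : ℕ) (M : Matrix (Fin n) (Fin n) ℂ) :
    Matrix (Fin n) (Fin n) ℂ :=
  let Y := {v : Fin n // x ≤ v.val + 1 ∧ v.val + 1 ≤ y}
  let T : Matrix (Fin n) (Fin n) ℂ :=
    M.submatrix id (Subtype.val : Y → Fin n) *
      pinv (M.submatrix (Subtype.val : Y → Fin n) Subtype.val) *
      M.submatrix (Subtype.val : Y → Fin n) id
  fun u v =>
    if u.val + 1 < x ∧ y < v.val + 1 ∧ v.val + 1 ≤ z then T u v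
    else if v.val + 1 < x ∧ y < u.val + 1 ∧ u.val + 1 ≤ z then star (T v u)
    else M u v

/-- The state `(l₀, M)` of the staircase algorithm after the passes `1, …, i` of its loop. -/
noncomputable def staircaseLoop (G : SimpleGraph (Fin n)) (M : Matrix (Fin n) (Fin n) ℂ) :
    ℕ → ℕ × Matrix (Fin n) (Fin n) ℂ
  | 0 => (1, M)
  | i + 1 =>
    let s := staircaseLoop G M i
    if lastNeighbor G i < lastNeighbor G (i + 1) ∧ 2 ≤ i + 1 then
      (i + 1, staircaseFill (i + 1) (lastNeighbor G s.1) (lastNeighbor G (i + 1)) s.2)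
    else s

open Classical in
/-- The central completion of a partial matrix, computed by the staircase algorithm; unspecified
entries are initialised with `0` (for a banded pattern each of them is assigned before it is
read). -/
noncomputable def centralCompletion (H : PartialMatrix G) : Matrix (Fin n) (Fin n) ℂ :=
  (staircaseLoop G (fun i j => if h : InPattern G i j then H ⟨(i, j), h⟩ else 0) n).2

end Partial

/-! ### The parametrization of positive semidefinite completions -/

section Parametrization

variable {n : ℕ}

/-- `R` is an upper Cholesky factor of `K`: `R` is upper triangular, `K = R* R`, and a row of `R`
with zero diagonal entry vanishes (automatic if `K` is positive definite; for singular `K` this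
is the usual normalization of Cholesky factors). -/
def IsUpperCholesky (K R : Matrix (Fin n) (Fin n) ℂ) : Prop :=
  (∀ i j, j < i → R i j = 0) ∧ K = Rᴴ * R ∧ ∀ i, R i i = 0 → ∀ j, R i j = 0

/-- `L` is a lower Cholesky factor of `K`: `L` is lower triangular, `K = L* L`, and a row of `L`
with zero diagonal entry vanishes. -/
def IsLowerCholesky (K L : Matrix (Fin n) (Fin n) ℂ) : Prop :=
  (∀ i j, i < j → L i j = 0) ∧ K = Lᴴ * L ∧ ∀ i, L i i = 0 → ∀ j, L i j = 0

/-- The orthogonal complement of the range of `A`. -/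
def rangeOrth (A : Matrix (Fin n) (Fin n) ℂ) : Set (Fin n → ℂ) :=
  {x | ∀ v, star (A *ᵥ v) ⬝ᵥ x = 0}

/-- The parameter set: contractive (spectral norm at most one) upper triangular matrices supported
off the pattern that act as zero from `(ran R)ᗮ` and onto `(ran L)ᗮ`. -/
def gammaSet (G : SimpleGraph (Fin n)) (R L : Matrix (Fin n) (Fin n) ℂ) :
    Set (Matrix (Fin n) (Fin n) ℂ) :=
  {Γ | (∀ i j, InPattern G i j → Γ i j = 0) ∧
    ‖Matrix.toEuclideanCLM (n := Fin n) (𝕜 := ℂ) Γ‖ ≤ 1 ∧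
    (∀ i j, j < i → Γ i j = 0) ∧
    (∀ x ∈ rangeOrth R, Γ *ᵥ x = 0) ∧
    (∀ y ∈ rangeOrth L, ∀ x, star y ⬝ᵥ (Γ *ᵥ x) = 0)}

/-- `f(Γ) = R* (I + W Γ)^{-*} (I - Γ* Γ) (I + W Γ)⁻¹ R`. -/
noncomputable def psdParam (R W Γ : Matrix (Fin n) (Fin n) ℂ) : Matrix (Fin n) (Fin n) ℂ :=
  Rᴴ * ((1 + W * Γ)⁻¹)ᴴ * (1 - Γᴴ * Γ) * (1 + W * Γ)⁻¹ * R

/-- `g = (e^{iβ} F₁ + e^{iα} F₂) / sin (β - α)`. -/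
noncomputable def phaseCombine (α β : ℝ) (F₁ F₂ : Matrix (Fin n) (Fin n) ℂ) :
    Matrix (Fin n) (Fin n) ℂ :=
  (1 / (Real.sin (β - α) : ℂ)) •
    (Complex.exp (Complex.I * (β : ℂ)) • F₁ + Complex.exp (Complex.I * (α : ℂ)) • F₂)

end Parametrization

end PhaseCompletion

/-! Membership in the cone amounts to two semidefinite conditions: for $0<\beta-\alpha<\pi$, $X$
lies in $\mathcal C[\alpha,\beta]$ iff $\mathrm{Im}(e^{-i\alpha}X)\succeq0$ and
$-\mathrm{Im}(e^{-i\beta}X)\succeq0$ (`mem_phaseBoundedCone_iff`). An interval shorter than $\pi$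
leaves no room for the $2\times2$ blocks, and a simultaneous congruence diagonalization of the two
Hermitian matrices diagonalizes $X$. Since $X$ is recovered from the pair by `phaseCombine`, and the
pattern is symmetric, completions of $C$ in the cone correspond to pairs of semidefinite completions
of $H_\alpha(C)$ and $S_\beta(C)$ (`phaseCombine_bijOn`). Each of these two problems is solved
separately.

Let $K$ be the central completion of a Hermitian partial matrix with semidefinite clique blocks. The
staircase formula makes the newly filled columns Schur orthogonal to the rows above, and this yields
a unit lower triangular $U$, supported on the pattern, with $KU$ upper triangular
(`exists_adaptedBasis_centralCompletion`). Then $U^*KU$ is diagonal and nonnegative, so $K\succeq0$;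
moreover $LU$ is diagonal, and $RU=WLU$ shows that the pivot columns of $W$ vanish below the band
(`IsAdaptedBasis.unitary_apply_eq_zero`).

Every Hermitian completion is $K-X-X^*$ for a unique $X$ supported strictly above the band, and such
matrices are stable under multiplication by upper triangular ones. Expanding the parametrization
gives $f(\Gamma)=K-X-X^*$ with $X=L^*\Gamma(I+W\Gamma)^{-1}R$ (`psdParam_eq`). As $W\Gamma$ is
strictly upper triangular, the inverse exists and $X$ is again off the pattern. Conversely $X=L^*YR$
is solved for $Y$, and $\Gamma=Y(I-WY)^{-1}$ (`psdParam_bijOn`). For singular $K$ this needs $X$ and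
$X^*$ to annihilate $\ker K$, which positivity of the completion forces
(`IsAdaptedBasis.offPattern_mul_eq_zero`). -/

namespace PhaseCompletion

open scoped ComplexOrder MatrixOrder

/-! ### Triangular matrices with normalized rows -/

section Triangular

variable {n : ℕ}

/-- The coordinate projection onto the indices at which the diagonal of `R` does not vanish. -/
noncomputable def pivotProj (R : Matrix (Fin n) (Fin n) ℂ) : Matrix (Fin n) (Fin n) ℂ :=
  Matrix.diagonal fun i => if R i i = 0 then 0 else 1

theorem pivotProj_conjTranspose (R : Matrix (Fin n) (Fin n) ℂ) :
    (pivotProj R)ᴴ = pivotProj R := by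
  rw [pivotProj, Matrix.diagonal_conjTranspose]
  congr 1
  funext i
  by_cases h : R i i = 0 <;> simp [h]

theorem pivotProj_mul_self (R : Matrix (Fin n) (Fin n) ℂ) :
    pivotProj R * pivotProj R = pivotProj R := by
  rw [pivotProj, Matrix.diagonal_mul_diagonal]
  congr 1
  funext i
  by_cases h : R i i = 0 <;> simp [h]

theorem pivotProj_mul_eq_iff {R X : Matrix (Fin n) (Fin n) ℂ} :
    pivotProj R * X = X ↔ ∀ i j, R i i = 0 → X i j = 0 := by
  constructor
  · intro h i j hi
    rw [← h, pivotProj, Matrix.diagonal_mul, if_pos hi, zero_mul]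
  · intro h
    ext i j
    rw [pivotProj, Matrix.diagonal_mul]
    split_ifs with hi
    · rw [h i j hi, zero_mul]
    · rw [one_mul]

theorem mul_pivotProj_eq_iff {R X : Matrix (Fin n) (Fin n) ℂ} :
    X * pivotProj R = X ↔ ∀ i j, R j j = 0 → X i j = 0 := by
  constructor
  · intro h i j hj
    rw [← h, pivotProj, Matrix.mul_diagonal, if_pos hj, mul_zero]
  · intro h
    ext i j
    rw [pivotProj, Matrix.mul_diagonal]
    split_ifs with hj
    · rw [h i j hj, zero_mul]
    · rw [mul_one]

theorem BlockTriangular.exists_inverse {α : Type*} [LinearOrder α] {b : Fin n → α}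
    {S : Matrix (Fin n) (Fin n) ℂ} (hS : S.BlockTriangular b) (hu : IsUnit S) :
    ∃ S' : Matrix (Fin n) (Fin n) ℂ, S * S' = 1 ∧ S' * S = 1 ∧ S'.BlockTriangular b := by
  have hd : IsUnit S.det := (Matrix.isUnit_iff_isUnit_det S).mp hu
  have := Matrix.invertibleOfIsUnitDet S hd
  exact ⟨S⁻¹, Matrix.mul_nonsing_inv S hd, Matrix.nonsing_inv_mul S hd,
    Matrix.blockTriangular_inv_of_blockTriangular hS⟩

theorem IsUpperTriangular.isUnit {S : Matrix (Fin n) (Fin n) ℂ} (hS : S.IsUpperTriangular)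
    (hd : ∀ i, S i i ≠ 0) : IsUnit S := by
  rw [Matrix.isUnit_iff_isUnit_det, Matrix.det_of_isUpperTriangular hS, isUnit_iff_ne_zero]
  exact Finset.prod_ne_zero_iff.mpr fun i _ => hd i

theorem IsLowerTriangular.isUnit {S : Matrix (Fin n) (Fin n) ℂ} (hS : S.IsLowerTriangular)
    (hd : ∀ i, S i i ≠ 0) : IsUnit S := by
  rw [Matrix.isUnit_iff_isUnit_det, Matrix.det_of_isLowerTriangular _ hS, isUnit_iff_ne_zero]
  exact Finset.prod_ne_zero_iff.mpr fun i _ => hd i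

/-- A triangular matrix whose rows with zero diagonal entry vanish is the product of a coordinate
projection and an invertible triangular matrix. -/
theorem BlockTriangular.exists_pivot_factorization {α : Type*} [LinearOrder α] {b : Fin n → α}
    (hb : ∀ S : Matrix (Fin n) (Fin n) ℂ, S.BlockTriangular b → (∀ i, S i i ≠ 0) → IsUnit S)
    {R : Matrix (Fin n) (Fin n) ℂ} (hR : R.BlockTriangular b)
    (hz : ∀ i, R i i = 0 → ∀ j, R i j = 0) :
    ∃ S S' : Matrix (Fin n) (Fin n) ℂ, S * S' = 1 ∧ S' * S = 1 ∧ S.BlockTriangular b ∧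
      S'.BlockTriangular b ∧ pivotProj R * S = R := by
  -- A $1$ at every vanishing pivot makes the matrix invertible; the projection erases exactly the
  -- rows altered this way.
  set S := R + Matrix.diagonal fun i => if R i i = 0 then (1 : ℂ) else 0 with hSdef
  have hS : S.BlockTriangular b := hR.add (Matrix.blockTriangular_diagonal _)
  have hd : ∀ i, S i i ≠ 0 := by
    intro i
    by_cases h : R i i = 0 <;> simp [hSdef, h]
  obtain ⟨S', h1, h2, h3⟩ := BlockTriangular.exists_inverse hS (hb S hS hd)
  refine ⟨S, S', h1, h2, hS, h3, ?_⟩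
  ext i j
  rw [pivotProj, Matrix.diagonal_mul, hSdef, Matrix.add_apply]
  split_ifs with hi
  · rw [hz i hi j, zero_mul]
  · by_cases hij : i = j
    · subst hij; simp [hi]
    · simp [hij]

theorem IsUpperTriangular.conjTranspose {A : Matrix (Fin n) (Fin n) ℂ}
    (hA : A.IsUpperTriangular) : Aᴴ.IsLowerTriangular := fun i j hij => by
  rw [Matrix.conjTranspose_apply, hA (i := j) (j := i) hij, star_zero]

theorem IsLowerTriangular.conjTranspose {A : Matrix (Fin n) (Fin n) ℂ}
    (hA : A.IsLowerTriangular) : Aᴴ.IsUpperTriangular := fun i j hij => by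
  rw [Matrix.conjTranspose_apply, hA (i := j) (j := i) hij, star_zero]

end Triangular

/-! ### Matrices supported strictly above a banded pattern -/

section OffPattern

variable {n : ℕ} {G : SimpleGraph (Fin n)}

theorem InPattern.of_le (hG : IsBanded G) {i j k l : Fin n} (h : InPattern G i j) (hik : i ≤ k)
    (hkl : k ≤ l) (hlj : l ≤ j) : InPattern G k l := by
  rcases hkl.eq_or_lt with rfl | hkl
  · exact Or.inl rfl
  · have hij : i < j := hik.trans_lt (hkl.trans_le hlj)
    exact Or.inr (hG i j hij (h.resolve_left hij.ne) k l hik hkl hlj)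

/-- `X` is upper triangular and vanishes on the pattern. -/
def IsOffPattern (G : SimpleGraph (Fin n)) (X : Matrix (Fin n) (Fin n) ℂ) : Prop :=
  ∀ i j, j < i ∨ InPattern G i j → X i j = 0

/-- Bandedness makes the off-pattern upper positions an ideal: if $(i,j)$ is in the pattern and
$i\le k\le j$, then so is $(k,j)$, and every term of the product vanishes. -/
theorem IsOffPattern.mul_left (hG : IsBanded G) {A X : Matrix (Fin n) (Fin n) ℂ}
    (hX : IsOffPattern G X) (hA : A.IsUpperTriangular) : IsOffPattern G (A * X) := by
  intro i j hij
  rw [Matrix.mul_apply]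
  refine Finset.sum_eq_zero fun k _ => ?_
  rcases lt_or_ge k i with hki | hki
  · rw [hA hki, zero_mul]
  rcases lt_or_ge j k with hjk | hjk
  · rw [hX k j (Or.inl hjk), mul_zero]
  rcases hij with hij | hij
  · exact absurd (hki.trans hjk) (not_le.mpr hij)
  · rw [hX k j (Or.inr (hij.of_le hG hki hjk le_rfl)), mul_zero]

theorem IsOffPattern.mul_right (hG : IsBanded G) {A X : Matrix (Fin n) (Fin n) ℂ}
    (hX : IsOffPattern G X) (hA : A.IsUpperTriangular) : IsOffPattern G (X * A) := by
  intro i j hij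
  rw [Matrix.mul_apply]
  refine Finset.sum_eq_zero fun k _ => ?_
  rcases lt_or_ge j k with hjk | hjk
  · rw [hA (i := k) (j := j) hjk, mul_zero]
  rcases lt_or_ge k i with hki | hki
  · rw [hX i k (Or.inl hki), zero_mul]
  rcases hij with hij | hij
  · exact absurd (hki.trans hjk) (not_le.mpr hij)
  · rw [hX i k (Or.inr (hij.of_le hG le_rfl hki hjk)), zero_mul]

/-- A nonzero $X_{lj}$ has $l<j$ with $(l,j)$ outside the pattern. For $j\le k$ the pair $(l,k)$ is
then outside as well, so $V_{kl}=0$. -/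
theorem mul_offPattern_strictUpper (hG : IsBanded G) {V X : Matrix (Fin n) (Fin n) ℂ}
    (hV : ∀ k l, l < k → ¬InPattern G l k → V k l = 0) (hX : IsOffPattern G X) :
    ∀ k j, j ≤ k → (V * X) k j = 0 := by
  intro k j hjk
  rw [Matrix.mul_apply]
  refine Finset.sum_eq_zero fun l _ => ?_
  rcases lt_or_ge j l with hjl | hlj
  · rw [hX l j (Or.inl hjl), mul_zero]
  by_cases hp : InPattern G l k
  · rw [hX l j (Or.inr (hp.of_le hG le_rfl hlj hjk)), mul_zero]
  · have hlk : l < k := (hlj.trans hjk).lt_of_ne fun h => hp (Or.inl h)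
    rw [hV k l hlk hp, zero_mul]

theorem isUnit_one_add_of_strictUpper {N : Matrix (Fin n) (Fin n) ℂ}
    (hN : ∀ k j, j ≤ k → N k j = 0) : (1 + N).IsUpperTriangular ∧ IsUnit (1 + N) := by
  have h : (1 + N).IsUpperTriangular := fun i j hij => by
    have hij : j < i := hij
    rw [Matrix.add_apply, hN i j hij.le, Matrix.one_apply_ne hij.ne', add_zero]
  refine ⟨h, IsUpperTriangular.isUnit h fun i => ?_⟩
  rw [Matrix.add_apply, hN i i le_rfl, Matrix.one_apply_eq, add_zero]
  exact one_ne_zero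

theorem IsOffPattern.eq_of_add_conjTranspose_eq {X X' : Matrix (Fin n) (Fin n) ℂ}
    (hX : IsOffPattern G X) (hX' : IsOffPattern G X') (h : X + Xᴴ = X' + X'ᴴ) : X = X' := by
  ext i j
  rcases lt_or_ge j i with hij | hij
  · rw [hX i j (Or.inl hij), hX' i j (Or.inl hij)]
  · rcases hij.eq_or_lt with rfl | hij
    · rw [hX i i (Or.inr (Or.inl rfl)), hX' i i (Or.inr (Or.inl rfl))]
    · have := congrFun (congrFun h i) j
      simpa [Matrix.add_apply, hX j i (Or.inl hij), hX' j i (Or.inl hij)] using this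

end OffPattern

/-! ### Lower triangular bases adapted to the pattern -/

section AdaptedBasis

variable {n : ℕ} {G : SimpleGraph (Fin n)}

/-- The columns of `U` form a unit lower triangular basis supported on the pattern, and `K * U`
is upper triangular: the pattern carries the Cholesky structure of `K`. -/
structure IsAdaptedBasis (G : SimpleGraph (Fin n)) (K U : Matrix (Fin n) (Fin n) ℂ) : Prop where
  diag : ∀ i, U i i = 1
  supp : ∀ i j, U i j ≠ 0 → j ≤ i ∧ InPattern G j i
  upper : (K * U).IsUpperTriangular

variable {K U L R W : Matrix (Fin n) (Fin n) ℂ}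

theorem IsAdaptedBasis.lower (hU : IsAdaptedBasis G K U) : U.IsLowerTriangular := fun i j hij => by
  by_contra h
  exact absurd (hU.supp i j h).1 (not_le.mpr hij)

theorem IsAdaptedBasis.isUnit (hU : IsAdaptedBasis G K U) : IsUnit U :=
  IsLowerTriangular.isUnit hU.lower fun i => by rw [hU.diag]; exact one_ne_zero

/-- The product is lower triangular by construction. It is also upper triangular, because
$KU=L^*(LU)$ and $L^*$ can be replaced by an invertible upper triangular factor: the projection it
contains acts trivially on $L$. -/
theorem IsAdaptedBasis.cholesky_mul (hU : IsAdaptedBasis G K U) (hL : IsLowerCholesky K L) :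
    L * U = Matrix.diagonal fun i => L i i := by
  obtain ⟨hL1, hL2, hL3⟩ := hL
  have hLt : L.IsLowerTriangular := fun i j hij => hL1 i j hij
  have hlow : (L * U).IsLowerTriangular := hLt.mul hU.lower
  have hup : (L * U).IsUpperTriangular := by
    obtain ⟨S, S', h1, h2, hS, hS', hE⟩ := BlockTriangular.exists_pivot_factorization
      (fun S => IsLowerTriangular.isUnit) hLt hL3
    have hEL : pivotProj L * L = L := pivotProj_mul_eq_iff.mpr fun i j hi => hL3 i hi j
    have hLH : Lᴴ = Sᴴ * pivotProj L := by
      rw [← pivotProj_conjTranspose L, ← Matrix.conjTranspose_mul, hE]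
    have key : S'ᴴ * (K * U) = L * U := by
      calc S'ᴴ * (K * U) = S'ᴴ * Sᴴ * ((pivotProj L * L) * U) := by
            rw [hL2, hLH]; simp only [Matrix.mul_assoc]
        _ = L * U := by
            rw [← Matrix.conjTranspose_mul, h1, hEL, Matrix.conjTranspose_one, Matrix.one_mul]
    rw [← key]
    exact (IsLowerTriangular.conjTranspose hS').mul hU.upper
  ext i j
  rcases lt_trichotomy i j with hij | rfl | hij
  · rw [hlow hij, Matrix.diagonal_apply_ne _ hij.ne]
  · rw [Matrix.diagonal_apply_eq, Matrix.mul_apply, Finset.sum_eq_single i, hU.diag, mul_one]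
    · intro k _ hk
      rcases lt_or_gt_of_ne hk with h | h
      · rw [hU.lower (i := k) (j := i) h, mul_zero]
      · rw [hL1 i k h, zero_mul]
    · exact fun h => absurd (Finset.mem_univ i) h
  · rw [hup hij, Matrix.diagonal_apply_ne _ hij.ne']

/-- In $(RU)_{kl}$ only neighbours $m\ge k$ of $l$ could contribute, and by bandedness there are
none when $(l,k)$ is off the pattern. On the other hand $RU=W(LU)$ has entry $W_{kl}L_{ll}$ there.
-/
theorem IsAdaptedBasis.unitary_apply_eq_zero (hG : IsBanded G) (hU : IsAdaptedBasis G K U)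
    (hL : IsLowerCholesky K L) (hR : R.IsUpperTriangular) (hW : R = W * L) {k l : Fin n}
    (hl : L l l ≠ 0) (hlk : l < k) (hp : ¬InPattern G l k) : W k l = 0 := by
  have h1 : (R * U) k l = 0 := by
    rw [Matrix.mul_apply]
    refine Finset.sum_eq_zero fun m _ => ?_
    rcases lt_or_ge m k with hmk | hkm
    · rw [hR hmk, zero_mul]
    by_cases hm : U m l = 0
    · rw [hm, mul_zero]
    · exact absurd ((hU.supp m l hm).2.of_le hG le_rfl hlk.le hkm) hp
  rw [hW, Matrix.mul_assoc, hU.cholesky_mul hL, Matrix.mul_diagonal] at h1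
  exact (mul_eq_zero.mp h1).resolve_right hl

/-- The columns of $U$ at the vanishing pivots span $\ker K$, so it suffices to test $B$ on them. -/
theorem IsAdaptedBasis.mul_eq_zero_of_kernel (hU : IsAdaptedBasis G K U)
    (hL : IsLowerCholesky K L) {B Z : Matrix (Fin n) (Fin n) ℂ}
    (hB : ∀ l, L l l = 0 → ∀ i, (B * U) i l = 0) (hZ : K * Z = 0) : B * Z = 0 := by
  have hLZ : L * Z = 0 := by
    rw [← Matrix.conjTranspose_mul_self_eq_zero, Matrix.conjTranspose_mul, Matrix.mul_assoc,
      ← Matrix.mul_assoc Lᴴ, ← hL.2.1, hZ, Matrix.mul_zero]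
  obtain ⟨U', h1, -, -⟩ := BlockTriangular.exists_inverse hU.lower hU.isUnit
  have hD : Matrix.diagonal (fun i => L i i) * (U' * Z) = 0 := by
    rw [← hU.cholesky_mul hL, Matrix.mul_assoc, ← Matrix.mul_assoc U, h1, Matrix.one_mul, hLZ]
  have hBZ : B * Z = (B * U) * (U' * Z) := by
    rw [Matrix.mul_assoc, ← Matrix.mul_assoc U, h1, Matrix.one_mul]
  rw [hBZ]
  ext i j
  rw [Matrix.mul_apply]
  refine Finset.sum_eq_zero fun l _ => ?_
  by_cases hl : L l l = 0
  · rw [hB l hl, zero_mul]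
  · have := congrFun (congrFun hD l) j
    rw [Matrix.diagonal_mul] at this
    rw [(mul_eq_zero.mp this).resolve_left hl, mul_zero]

theorem IsAdaptedBasis.mulVec_col_eq_zero (hU : IsAdaptedBasis G K U) (hL : IsLowerCholesky K L)
    {l : Fin n} (hl : L l l = 0) : K *ᵥ (fun i => U i l) = 0 := by
  funext i
  have h : (K * U) i l = 0 := by
    rw [hL.2.1, Matrix.mul_assoc, hU.cholesky_mul hL, Matrix.mul_diagonal, hl, mul_zero]
  exact h

end AdaptedBasis


/-! ### Contractions and the parameter set -/

section Contractions

variable {n : ℕ} {G : SimpleGraph (Fin n)}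

theorem mulVec_apply_eq_zero {A : Matrix (Fin n) (Fin n) ℂ} {x : Fin n → ℂ} {i : Fin n}
    (h : ∀ j, A i j * x j = 0) : (A *ᵥ x) i = 0 := by
  change ∑ j, A i j * x j = 0
  exact Finset.sum_eq_zero fun j _ => h j

theorem star_dotProduct_self_eq_norm_sq (x : Fin n → ℂ) :
    star x ⬝ᵥ x = ((‖WithLp.toLp 2 x‖ ^ 2 : ℝ) : ℂ) := by
  rw [EuclideanSpace.norm_sq_eq]
  push_cast
  exact Finset.sum_congr rfl fun i _ => Complex.conj_mul' (x i)

theorem dotProduct_one_sub_conjTranspose_mul_self (A : Matrix (Fin n) (Fin n) ℂ) (x : Fin n → ℂ) :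
    star x ⬝ᵥ ((1 - Aᴴ * A) *ᵥ x)
      = ((‖WithLp.toLp 2 x‖ ^ 2 - ‖WithLp.toLp 2 (A *ᵥ x)‖ ^ 2 : ℝ) : ℂ) := by
  rw [Matrix.sub_mulVec, Matrix.one_mulVec, dotProduct_sub, star_dotProduct_self_eq_norm_sq,
    ← Matrix.mulVec_mulVec, Matrix.dotProduct_mulVec, Matrix.vecMul_conjTranspose, star_star,
    star_dotProduct_self_eq_norm_sq]
  push_cast
  rfl

theorem norm_le_one_iff_posSemidef (A : Matrix (Fin n) (Fin n) ℂ) :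
    ‖Matrix.toEuclideanCLM (n := Fin n) (𝕜 := ℂ) A‖ ≤ 1 ↔ (1 - Aᴴ * A).PosSemidef := by
  have hA : (1 - Aᴴ * A).IsHermitian :=
    Matrix.isHermitian_one.sub (Matrix.isHermitian_conjTranspose_mul_self A)
  rw [Matrix.posSemidef_iff_dotProduct_mulVec, and_iff_right hA]
  simp only [dotProduct_one_sub_conjTranspose_mul_self, Complex.zero_le_real, sub_nonneg]
  rw [ContinuousLinearMap.opNorm_le_iff zero_le_one]
  constructor
  · intro h x
    have := h (WithLp.toLp 2 x)
    rw [one_mul, Matrix.toEuclideanCLM_toLp] at this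
    exact pow_le_pow_left₀ (norm_nonneg _) this 2
  · intro h x
    rw [one_mul]
    exact (pow_le_pow_iff_left₀ (norm_nonneg _) (norm_nonneg _) two_ne_zero).mp (h (WithLp.ofLp x))

/-- Since $R$ is the pivot projection times an invertible matrix, its range is the coordinate
subspace of the pivots. The general order `b` covers upper and lower factors at once. -/
theorem mem_rangeOrth_iff {α : Type*} [LinearOrder α] {b : Fin n → α}
    (hb : ∀ S : Matrix (Fin n) (Fin n) ℂ, S.BlockTriangular b → (∀ i, S i i ≠ 0) → IsUnit S)
    {R : Matrix (Fin n) (Fin n) ℂ} (hR : R.BlockTriangular b)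
    (hz : ∀ i, R i i = 0 → ∀ j, R i j = 0) {x : Fin n → ℂ} :
    x ∈ rangeOrth R ↔ ∀ i, R i i ≠ 0 → x i = 0 := by
  constructor
  · intro hx i hi
    obtain ⟨S, S', h1, -, -, -, hE⟩ := BlockTriangular.exists_pivot_factorization hb hR hz
    have h := hx (S' *ᵥ Pi.single i 1)
    have hv : R *ᵥ (S' *ᵥ Pi.single i 1) = Pi.single i 1 := by
      rw [← hE, Matrix.mulVec_mulVec, Matrix.mul_assoc, h1, Matrix.mul_one, pivotProj]
      funext j
      rw [Matrix.mulVec_diagonal]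
      by_cases hj : j = i
      · subst hj; simp [hi]
      · simp [hj]
    rw [hv, ← Pi.single_star, star_one, single_one_dotProduct] at h
    exact h
  · intro hx v
    refine Finset.sum_eq_zero fun i _ => ?_
    by_cases hi : R i i = 0
    · have : (R *ᵥ v) i = 0 := mulVec_apply_eq_zero fun j => by rw [hz i hi j, zero_mul]
      rw [Pi.star_apply, this, star_zero, zero_mul]
    · rw [hx i hi, mul_zero]

/-- Turns the geometric constraints on $\Gamma$ into matrix identities that can be carried through
the algebra. -/
theorem mem_gammaSet_iff {K K' R L Γ : Matrix (Fin n) (Fin n) ℂ} (hR : IsUpperCholesky K R)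
    (hL : IsLowerCholesky K' L) :
    Γ ∈ gammaSet G R L ↔ IsOffPattern G Γ ∧ (1 - Γᴴ * Γ).PosSemidef ∧
      pivotProj L * Γ = Γ ∧ Γ * pivotProj R = Γ := by
  have hRt : R.IsUpperTriangular := fun i j h => hR.1 i j h
  have hLt : L.IsLowerTriangular := fun i j h => hL.1 i j h
  have memR : ∀ x, x ∈ rangeOrth R ↔ ∀ i, R i i ≠ 0 → x i = 0 := fun x =>
    mem_rangeOrth_iff (fun S => IsUpperTriangular.isUnit) hRt hR.2.2
  have memL : ∀ x, x ∈ rangeOrth L ↔ ∀ i, L i i ≠ 0 → x i = 0 := fun x =>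
    mem_rangeOrth_iff (fun S => IsLowerTriangular.isUnit) hLt hL.2.2
  have single_mem : ∀ (A : Matrix (Fin n) (Fin n) ℂ) (j : Fin n), A j j = 0 →
      ∀ i, A i i ≠ 0 → (Pi.single j 1 : Fin n → ℂ) i = 0 := by
    intro A j hj i hi
    exact Pi.single_eq_of_ne (fun h : i = j => hi (h ▸ hj)) 1
  rw [pivotProj_mul_eq_iff, mul_pivotProj_eq_iff]
  constructor
  · rintro ⟨h1, h2, h3, h4, h5⟩
    refine ⟨fun i j h => h.elim (h3 i j) (h1 i j), (norm_le_one_iff_posSemidef Γ).mp h2,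
      fun i j hi => ?_, fun i j hj => ?_⟩
    · have := h5 _ ((memL _).mpr (single_mem L i hi)) (Pi.single j 1)
      rwa [← Pi.single_star, star_one, single_one_dotProduct, Matrix.mulVec_single_one] at this
    · have := congrFun (h4 _ ((memR _).mpr (single_mem R j hj))) i
      rwa [Matrix.mulVec_single_one] at this
  · rintro ⟨h1, h2, h3, h4⟩
    refine ⟨fun i j h => h1 i j (Or.inr h), (norm_le_one_iff_posSemidef Γ).mpr h2,
      fun i j h => h1 i j (Or.inl h), fun x hx => ?_, fun y hy x => ?_⟩
    · funext i
      refine mulVec_apply_eq_zero fun j => ?_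
      by_cases hj : R j j = 0
      · rw [h4 i j hj, zero_mul]
      · rw [(memR x).mp hx j hj, mul_zero]
    · refine Finset.sum_eq_zero fun i _ => ?_
      by_cases hi : L i i = 0
      · have : (Γ *ᵥ x) i = 0 := mulVec_apply_eq_zero fun j => by rw [h3 i j hi, zero_mul]
        rw [this, mul_zero]
      · rw [Pi.star_apply, (memL y).mp hy i hi, star_zero, zero_mul]

end Contractions

/-! ### The parametrization of positive semidefinite completions -/

section Bijection

variable {n : ℕ} {G : SimpleGraph (Fin n)} {K U L R W : Matrix (Fin n) (Fin n) ℂ}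

theorem IsOffPattern.isCompletion_sub {H : PartialMatrix G} {X : Matrix (Fin n) (Fin n) ℂ}
    (hX : IsOffPattern G X) (hK : IsCompletion H K) : IsCompletion H (K - X - Xᴴ) := by
  intro p
  rw [Matrix.sub_apply, Matrix.sub_apply, Matrix.conjTranspose_apply, hX _ _ (Or.inr p.2),
    hX _ _ (Or.inr p.2.symm), star_zero, sub_zero, sub_zero, hK p]

theorem exists_offPattern_of_completions {H : PartialMatrix G} {F : Matrix (Fin n) (Fin n) ℂ}
    (hK : IsCompletion H K) (hF : IsCompletion H F) (hKh : K.IsHermitian) (hFh : F.IsHermitian) :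
    ∃ X, IsOffPattern G X ∧ F = K - X - Xᴴ := by
  classical
  refine ⟨Matrix.of fun i j => if j < i ∨ InPattern G i j then 0 else K i j - F i j,
    fun i j h => if_pos h, ?_⟩
  have hd : ∀ i j, InPattern G i j → K i j = F i j := fun i j h =>
    (hK ⟨(i, j), h⟩).trans (hF ⟨(i, j), h⟩).symm
  ext i j
  simp only [Matrix.sub_apply, Matrix.conjTranspose_apply, Matrix.of_apply]
  by_cases hp : InPattern G i j
  · simp [hp, hp.symm, hd i j hp]
  · have hp' : ¬InPattern G j i := fun h => hp h.symm
    have hne : i ≠ j := fun h => hp (Or.inl h)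
    rcases lt_or_gt_of_ne hne with h | h
    · simp [hp, hp', h, h.not_gt]
    · simp only [hp, hp', h, or_false, if_true, h.not_gt, if_false, star_sub]
      rw [← Matrix.conjTranspose_apply, ← Matrix.conjTranspose_apply, hKh.eq, hFh.eq]
      ring

theorem star_dotProduct_mulVec_eq_zero {A : Matrix (Fin n) (Fin n) ℂ} {u : Fin n → ℂ}
    (h : ∀ i j, u i ≠ 0 → u j ≠ 0 → A i j = 0) : star u ⬝ᵥ (A *ᵥ u) = 0 := by
  refine Finset.sum_eq_zero fun i _ => ?_
  by_cases hi : u i = 0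
  · rw [Pi.star_apply, hi, star_zero, zero_mul]
  · have : (A *ᵥ u) i = 0 := mulVec_apply_eq_zero fun j => by
      by_cases hj : u j = 0
      · rw [hj, mul_zero]
      · rw [h i j hi hj, zero_mul]
    rw [this, mul_zero]

/-- A Hermitian off-pattern perturbation that keeps `K` positive semidefinite annihilates the
basis vectors in the kernel of `K`. -/
theorem IsAdaptedBasis.offPattern_mul_eq_zero (hG : IsBanded G) (hU : IsAdaptedBasis G K U)
    (hL : IsLowerCholesky K L) {X : Matrix (Fin n) (Fin n) ℂ} (hX : IsOffPattern G X)
    (hF : (K - X - Xᴴ).PosSemidef) {l : Fin n} (hl : L l l = 0) (i : Fin n) :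
    (X * U) i l = 0 ∧ (Xᴴ * U) i l = 0 := by
  set u : Fin n → ℂ := fun i => U i l with hu
  have hXu : ∀ i j, u i ≠ 0 → u j ≠ 0 → X i j = 0 := by
    intro i j hi hj
    rcases lt_or_ge j i with h | h
    · exact hX i j (Or.inl h)
    · exact hX i j (Or.inr ((hU.supp j l hj).2.of_le hG (hU.supp i l hi).1 h le_rfl))
  have hKu : K *ᵥ u = 0 := hU.mulVec_col_eq_zero hL hl
  -- The support of $u$ is a clique, where $X$ vanishes. A null vector of the quadratic form of a
  -- semidefinite matrix lies in its kernel, hence $Xu+X^*u=0$.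
  have hq : star u ⬝ᵥ ((K - X - Xᴴ) *ᵥ u) = 0 := by
    rw [Matrix.sub_mulVec, Matrix.sub_mulVec, hKu, dotProduct_sub, dotProduct_sub,
      dotProduct_zero, star_dotProduct_mulVec_eq_zero hXu, star_dotProduct_mulVec_eq_zero
      (A := Xᴴ), sub_zero, sub_zero]
    intro i j hi hj
    rw [Matrix.conjTranspose_apply, hXu j i hj hi, star_zero]
  have hFu := congrFun ((hF.dotProduct_mulVec_zero_iff u).mp hq) i
  rw [Matrix.sub_mulVec, Matrix.sub_mulVec, hKu] at hFu
  have hsum : (X * U) i l + (Xᴴ * U) i l = 0 := by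
    have : (0 : Fin n → ℂ) i - (X *ᵥ u) i - (Xᴴ *ᵥ u) i = 0 := hFu
    rw [Pi.zero_apply] at this
    change (X *ᵥ u) i + (Xᴴ *ᵥ u) i = 0
    linear_combination -this
  by_cases hz : (X * U) i l = 0
  · rw [hz, zero_add] at hsum
    exact ⟨hz, hsum⟩
  -- The vectors $Xu$ and $X^*u$ have disjoint supports. A common index $i$ would give $k\le i\le j$
  -- in the support of $u$ (for $k$ and $j$) with $X_{ki}\ne0$, but $(k,i)$ lies in the pattern
  -- because $(l,j)$ does and $l\le k$.
  · have hz' : (Xᴴ * U) i l = 0 := by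
      rw [Matrix.mul_apply] at hz
      obtain ⟨j, -, hj⟩ := Finset.exists_ne_zero_of_sum_ne_zero hz
      have hXij := left_ne_zero_of_mul hj
      have hUj := hU.supp j l (right_ne_zero_of_mul hj)
      rw [Matrix.mul_apply]
      refine Finset.sum_eq_zero fun k _ => ?_
      by_contra hk
      have hXki : X k i ≠ 0 := fun h => left_ne_zero_of_mul hk (by
        rw [Matrix.conjTranspose_apply, h, star_zero])
      have hUk := hU.supp k l (right_ne_zero_of_mul hk)
      have hij : i ≤ j := not_lt.mp fun h => hXij (hX i j (Or.inl h))
      have hki : k ≤ i := not_lt.mp fun h => hXki (hX k i (Or.inl h))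
      exact hXki (hX k i (Or.inr (hUj.2.of_le hG hUk.1 hki hij)))
    rw [hz', add_zero] at hsum
    exact absurd hsum hz

/-- With $Y=\Gamma M$ one has $M=I-WY$. Unitarity cancels the quadratic terms, so
$M^*(I-\Gamma^*\Gamma)M=I-WY-Y^*W^*$; then $R^*W=L^*$ gives the linear form. -/
theorem psdParam_eq (hR : K = Rᴴ * R) (hW : Wᴴ * W = 1) (hRW : R = W * L)
    {Γ M : Matrix (Fin n) (Fin n) ℂ} (hM : (1 + W * Γ) * M = 1) :
    psdParam R W Γ = K - Lᴴ * (Γ * M) * R - (Lᴴ * (Γ * M) * R)ᴴ := by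
  have hinv : (1 + W * Γ)⁻¹ = M := Matrix.inv_eq_right_inv hM
  have hM1 : M = 1 - W * (Γ * M) := by
    rw [eq_sub_iff_add_eq, ← hM, Matrix.add_mul, Matrix.one_mul, Matrix.mul_assoc]
  have hRW' : Rᴴ * W = Lᴴ := by
    rw [hRW, Matrix.conjTranspose_mul, Matrix.mul_assoc, hW, Matrix.mul_one]
  have hRW'' : Wᴴ * R = L := by rw [hRW, ← Matrix.mul_assoc, hW, Matrix.one_mul]
  have h1 : Mᴴ * (1 - Γᴴ * Γ) * M = 1 - W * (Γ * M) - (Γ * M)ᴴ * Wᴴ := by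
    have e1 : Mᴴ * (1 - Γᴴ * Γ) * M = Mᴴ * M - (Γ * M)ᴴ * (Γ * M) := by
      rw [Matrix.conjTranspose_mul]; noncomm_ring
    rw [e1]
    generalize Γ * M = Y at hM1
    rw [hM1, Matrix.conjTranspose_sub, Matrix.conjTranspose_one, Matrix.conjTranspose_mul]
    have e2 : (1 - Yᴴ * Wᴴ) * (1 - W * Y) - Yᴴ * Y
        = 1 - W * Y - Yᴴ * Wᴴ + (Yᴴ * (Wᴴ * W) * Y - Yᴴ * Y) := by noncomm_ring
    rw [e2, hW, Matrix.mul_one, sub_self, add_zero]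
  have h2 : psdParam R W Γ = Rᴴ * (Mᴴ * (1 - Γᴴ * Γ) * M) * R := by
    rw [psdParam, hinv]; simp only [Matrix.mul_assoc]
  rw [h2, h1, hR]
  generalize Γ * M = Y
  calc Rᴴ * (1 - W * Y - Yᴴ * Wᴴ) * R
      = Rᴴ * R - (Rᴴ * W) * Y * R - Rᴴ * Yᴴ * (Wᴴ * R) := by noncomm_ring
    _ = Rᴴ * R - Lᴴ * Y * R - (Lᴴ * Y * R)ᴴ := by
        rw [hRW', hRW'']
        simp only [Matrix.conjTranspose_mul, Matrix.conjTranspose_conjTranspose, Matrix.mul_assoc]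

/-- Nothing is known about the columns of $W$ at vanishing pivots of $L$, but the range condition on
$X$ discards them. -/
theorem IsAdaptedBasis.unitary_mul_strictUpper (hG : IsBanded G) (hU : IsAdaptedBasis G K U)
    (hL : IsLowerCholesky K L) (hR : IsUpperCholesky K R) (hRW : R = W * L)
    {X : Matrix (Fin n) (Fin n) ℂ} (hX : IsOffPattern G X) (hXL : pivotProj L * X = X) :
    ∀ k j, j ≤ k → (W * X) k j = 0 := by
  rw [← hXL, ← Matrix.mul_assoc]
  refine mul_offPattern_strictUpper hG (fun k l hlk hp => ?_) hX
  rw [pivotProj, Matrix.mul_diagonal]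
  split_ifs with hl
  · rw [mul_zero]
  · rw [hU.unitary_apply_eq_zero hG hL (fun i j h => hR.1 i j h) hRW hl hlk hp, zero_mul]

theorem isUnit_one_add_of_mem_gammaSet (hG : IsBanded G) (hU : IsAdaptedBasis G K U)
    (hL : IsLowerCholesky K L) (hR : IsUpperCholesky K R) (hRW : R = W * L)
    {Γ : Matrix (Fin n) (Fin n) ℂ} (hΓ : Γ ∈ gammaSet G R L) :
    (1 + W * Γ).IsUpperTriangular ∧ IsUnit (1 + W * Γ) := by
  obtain ⟨h1, -, h3, -⟩ := (mem_gammaSet_iff hR hL).mp hΓ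
  exact isUnit_one_add_of_strictUpper (hU.unitary_mul_strictUpper hG hL hR hRW h1 h3)

/-- Both directions pass through $Y=\Gamma(I+W\Gamma)^{-1}$: it determines $\Gamma$ by
$\Gamma=Y(I-WY)^{-1}$, and the off-pattern part $X=L^*YR$ of the completion determines $Y$ within
the pivot coordinates. -/
theorem psdParam_bijOn (hG : IsBanded G) {H : PartialMatrix G} (hK : IsCompletion H K)
    (hU : IsAdaptedBasis G K U) (hL : IsLowerCholesky K L) (hR : IsUpperCholesky K R)
    (hW : Wᴴ * W = 1) (hRW : R = W * L) :
    Set.BijOn (psdParam R W) (gammaSet G R L) {F | F.PosSemidef ∧ IsCompletion H F} := by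
  have hRt : R.IsUpperTriangular := fun i j h => hR.1 i j h
  have hLt : L.IsLowerTriangular := fun i j h => hL.1 i j h
  have hLHt : Lᴴ.IsUpperTriangular := IsLowerTriangular.conjTranspose hLt
  obtain ⟨S, S', hS1, hS2, hS, hS', hES⟩ := BlockTriangular.exists_pivot_factorization
    (fun S => IsUpperTriangular.isUnit) hRt hR.2.2
  obtain ⟨T, T', hT1, hT2, hT, hT', hET⟩ := BlockTriangular.exists_pivot_factorization
    (fun S => IsLowerTriangular.isUnit) hLt hL.2.2
  have hRS : R * S' = pivotProj R := by
    nth_rewrite 1 [← hES]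
    rw [Matrix.mul_assoc, hS1, Matrix.mul_one]
  have hLT : L * T' = pivotProj L := by
    nth_rewrite 1 [← hET]
    rw [Matrix.mul_assoc, hT1, Matrix.mul_one]
  have hLH : Lᴴ = Tᴴ * pivotProj L := by
    rw [← pivotProj_conjTranspose L, ← Matrix.conjTranspose_mul, hET]
  have hTH : T'ᴴ * Tᴴ = 1 := by
    rw [← Matrix.conjTranspose_mul, hT1, Matrix.conjTranspose_one]
  have hTH' : Tᴴ * T'ᴴ = 1 := by
    rw [← Matrix.conjTranspose_mul, hT2, Matrix.conjTranspose_one]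
  have hpull : ∀ Y, pivotProj L * Y = Y → Y * pivotProj R = Y → Lᴴ * Y * R = Tᴴ * Y * S := by
    intro Y h1 h2
    calc Lᴴ * Y * R = Tᴴ * ((pivotProj L * Y) * pivotProj R) * S := by
          rw [hLH]; nth_rewrite 1 [← hES]; simp only [Matrix.mul_assoc]
      _ = Tᴴ * Y * S := by rw [h1, h2]
  have hcancel : ∀ Y, T'ᴴ * (Tᴴ * Y * S) * S' = Y := by
    intro Y
    calc T'ᴴ * (Tᴴ * Y * S) * S' = (T'ᴴ * Tᴴ) * Y * (S * S') := by simp only [Matrix.mul_assoc]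
      _ = Y := by rw [hTH, hS1, Matrix.one_mul, Matrix.mul_one]
  have hparam : ∀ Γ ∈ gammaSet G R L, ∃ M, (1 + W * Γ) * M = 1 ∧ M.IsUpperTriangular ∧
      pivotProj L * (Γ * M) = Γ * M ∧ (Γ * M) * pivotProj R = Γ * M := by
    intro Γ hΓ
    obtain ⟨hup, hun⟩ := isUnit_one_add_of_mem_gammaSet hG hU hL hR hRW hΓ
    obtain ⟨M, hM1, hM2, hM⟩ := BlockTriangular.exists_inverse hup hun
    obtain ⟨h1, h2, h3, h4⟩ := (mem_gammaSet_iff hR hL).mp hΓ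
    refine ⟨M, hM1, hM, by rw [← Matrix.mul_assoc, h3], ?_⟩
    -- Off the pivots of $R$ the matrix $\Gamma$ vanishes, so $I+W\Gamma$, and hence its inverse,
    -- acts as the identity.
    have e1 : (1 + W * Γ) * (1 - pivotProj R) = 1 - pivotProj R := by
      have : (1 + W * Γ) * (1 - pivotProj R)
          = (1 - pivotProj R) + W * (Γ - Γ * pivotProj R) := by noncomm_ring
      rw [this, h4, sub_self, Matrix.mul_zero, add_zero]
    have e2 : M * (1 - pivotProj R) = 1 - pivotProj R := by
      nth_rewrite 1 [← e1]
      rw [← Matrix.mul_assoc, hM2, Matrix.one_mul]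
    have e3 : Γ * M - (Γ * M) * pivotProj R = 0 := by
      calc Γ * M - (Γ * M) * pivotProj R = Γ * (M * (1 - pivotProj R)) := by noncomm_ring
        _ = Γ - Γ * pivotProj R := by rw [e2]; noncomm_ring
        _ = 0 := by rw [h4, sub_self]
    exact (sub_eq_zero.mp e3).symm
  refine ⟨fun Γ hΓ => ?_, fun Γ hΓ Γ' hΓ' hf => ?_, fun F hF => ?_⟩
  · obtain ⟨M, hM1, hM, -, -⟩ := hparam Γ hΓ
    obtain ⟨h1, h2, -, -⟩ := (mem_gammaSet_iff hR hL).mp hΓ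
    constructor
    · have : psdParam R W Γ
          = ((1 + W * Γ)⁻¹ * R)ᴴ * (1 - Γᴴ * Γ) * ((1 + W * Γ)⁻¹ * R) := by
        rw [psdParam, Matrix.conjTranspose_mul]; simp only [Matrix.mul_assoc]
      rw [this]
      exact h2.conjTranspose_mul_mul_same _
    · rw [psdParam_eq hR.2.1 hW hRW hM1]
      exact (((h1.mul_right hG hM).mul_left hG hLHt).mul_right hG hRt).isCompletion_sub hK
  · obtain ⟨M, hM1, hM, hl, hr⟩ := hparam Γ hΓ
    obtain ⟨M', hM1', hM', hl', hr'⟩ := hparam Γ' hΓ'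
    have h1 := ((mem_gammaSet_iff hR hL).mp hΓ).1
    have h1' := ((mem_gammaSet_iff hR hL).mp hΓ').1
    rw [psdParam_eq hR.2.1 hW hRW hM1, psdParam_eq hR.2.1 hW hRW hM1', sub_sub, sub_sub,
      sub_right_inj] at hf
    have hX := IsOffPattern.eq_of_add_conjTranspose_eq
      (((h1.mul_right hG hM).mul_left hG hLHt).mul_right hG hRt)
      (((h1'.mul_right hG hM').mul_left hG hLHt).mul_right hG hRt) hf
    rw [hpull _ hl hr, hpull _ hl' hr'] at hX
    have hY : Γ * M = Γ' * M' := by rw [← hcancel (Γ * M), hX, hcancel]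
    have hMM : M = M' := by
      have e1 : M = 1 - W * (Γ * M) := by
        rw [eq_sub_iff_add_eq, ← hM1, Matrix.add_mul, Matrix.one_mul, Matrix.mul_assoc]
      have e2 : M' = 1 - W * (Γ' * M') := by
        rw [eq_sub_iff_add_eq, ← hM1', Matrix.add_mul, Matrix.one_mul, Matrix.mul_assoc]
      rw [e1, e2, hY]
    have hM2 : M * (1 + W * Γ) = 1 := mul_eq_one_comm.mp hM1
    calc Γ = (Γ * M) * (1 + W * Γ) := by rw [Matrix.mul_assoc, hM2, Matrix.mul_one]
      _ = Γ' * (M * (1 + W * Γ)) := by rw [hY, ← hMM, Matrix.mul_assoc]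
      _ = Γ' := by rw [hM2, Matrix.mul_one]
  · obtain ⟨hFp, hFc⟩ := hF
    have hKh : K.IsHermitian := by rw [hR.2.1]; exact Matrix.isHermitian_conjTranspose_mul_self R
    obtain ⟨X, hX, rfl⟩ := exists_offPattern_of_completions hK hFc hKh hFp.1
    have hker := fun l hl i => hU.offPattern_mul_eq_zero hG hL hX hFp (l := l) hl i
    -- The columns of $S'(I-P_R)$ lie in $\ker R=\ker K$. This is what keeps $Y$ inside the pivot
    -- coordinates.
    have hXR : X * (S' * (1 - pivotProj R)) = 0 := by
      refine hU.mul_eq_zero_of_kernel hL (fun l hl i => (hker l hl i).1) ?_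
      rw [hR.2.1, Matrix.mul_assoc, ← Matrix.mul_assoc R, hRS, Matrix.mul_sub, Matrix.mul_one,
        pivotProj_mul_self, sub_self, Matrix.mul_zero]
    have hXL : Xᴴ * (T' * (1 - pivotProj L)) = 0 := by
      refine hU.mul_eq_zero_of_kernel hL (fun l hl i => (hker l hl i).2) ?_
      rw [hL.2.1, Matrix.mul_assoc, ← Matrix.mul_assoc L, hLT, Matrix.mul_sub, Matrix.mul_one,
        pivotProj_mul_self, sub_self, Matrix.mul_zero]
    set Y := T'ᴴ * X * S' with hYdef
    have hYR : Y * pivotProj R = Y := by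
      have : Y - Y * pivotProj R = T'ᴴ * (X * (S' * (1 - pivotProj R))) := by
        rw [hYdef]; noncomm_ring
      rw [hXR, Matrix.mul_zero] at this
      exact (sub_eq_zero.mp this).symm
    have hYL : pivotProj L * Y = Y := by
      have : Y - pivotProj L * Y = (Xᴴ * (T' * (1 - pivotProj L)))ᴴ * S' := by
        rw [hYdef, Matrix.conjTranspose_mul, Matrix.conjTranspose_mul,
          Matrix.conjTranspose_conjTranspose, Matrix.conjTranspose_sub, Matrix.conjTranspose_one,
          pivotProj_conjTranspose]
        noncomm_ring
      rw [hXL, Matrix.conjTranspose_zero, Matrix.zero_mul] at this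
      exact (sub_eq_zero.mp this).symm
    have hYX : Lᴴ * Y * R = X := by
      rw [hpull Y hYL hYR, hYdef]
      calc Tᴴ * (T'ᴴ * X * S') * S = (Tᴴ * T'ᴴ) * X * (S' * S) := by simp only [Matrix.mul_assoc]
        _ = X := by rw [hTH', hS2, Matrix.one_mul, Matrix.mul_one]
    have hYoff : IsOffPattern G Y :=
      (hX.mul_left hG (IsLowerTriangular.conjTranspose hT')).mul_right hG hS'
    have hWY := hU.unitary_mul_strictUpper hG hL hR hRW hYoff hYL
    obtain ⟨hMt, hMu⟩ := isUnit_one_add_of_strictUpper (N := -(W * Y)) fun k j h => by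
      rw [Matrix.neg_apply, hWY k j h, neg_zero]
    obtain ⟨M', hM1, hM2, hM't⟩ := BlockTriangular.exists_inverse hMt hMu
    set M := 1 + -(W * Y) with hMdef
    set Γ := Y * M' with hΓdef
    have hΓM : Γ * M = Y := by rw [hΓdef, Matrix.mul_assoc, hM2, Matrix.mul_one]
    have hinv : (1 + W * Γ) * M = 1 := by
      rw [Matrix.add_mul, Matrix.one_mul, Matrix.mul_assoc, hΓM, hMdef, neg_add_cancel_right]
    have hM'eq : 1 + W * Γ = M' := by
      calc 1 + W * Γ = (1 + W * Γ) * (M * M') := by rw [hM1, Matrix.mul_one]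
        _ = M' := by rw [← Matrix.mul_assoc, hinv, Matrix.one_mul]
    have hF : psdParam R W Γ = K - X - Xᴴ := by
      rw [psdParam_eq hR.2.1 hW hRW hinv, hΓM, hYX]
    have hΓL : pivotProj L * Γ = Γ := by rw [hΓdef, ← Matrix.mul_assoc, hYL]
    have hΓR : Γ * pivotProj R = Γ := by
      have e1 : M * (1 - pivotProj R) = 1 - pivotProj R := by
        have : M * (1 - pivotProj R) = (1 - pivotProj R) - W * (Y - Y * pivotProj R) := by
          rw [hMdef]; noncomm_ring
        rw [this, hYR, sub_self, Matrix.mul_zero, sub_zero]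
      have e2 : Γ - Γ * pivotProj R = 0 := by
        calc Γ - Γ * pivotProj R = Γ * (M * (1 - pivotProj R)) := by rw [e1]; noncomm_ring
          _ = Y - Y * pivotProj R := by rw [← Matrix.mul_assoc, hΓM]; noncomm_ring
          _ = 0 := by rw [hYR, sub_self]
      exact (sub_eq_zero.mp e2).symm
    refine ⟨Γ, (mem_gammaSet_iff hR hL).mpr ⟨hYoff.mul_right hG hM't, ?_, hΓL, hΓR⟩, hF⟩
    -- For contractivity, $Z$ is chosen with $MRZ=P_R$, a right inverse of $MR$ on the pivots. It
    -- exists because $W\Gamma$ has its range in that of $R$, and the congruence by $Z$ turns the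
    -- completion into $P_R-\Gamma^*\Gamma$.
    have hER : pivotProj R * R = R := pivotProj_mul_eq_iff.mpr fun i j hi => hR.2.2 i hi j
    have hWΓ : pivotProj R * (W * Γ) = W * Γ := by
      have : W * Γ = R * T' * Γ := by
        rw [hRW, Matrix.mul_assoc W, hLT, Matrix.mul_assoc, hΓL]
      rw [this, Matrix.mul_assoc R, ← Matrix.mul_assoc, hER]
    have hRZ : R * (S' * (M' * pivotProj R)) = M' * pivotProj R := by
      rw [← Matrix.mul_assoc, hRS, ← hM'eq, Matrix.add_mul, Matrix.one_mul, Matrix.mul_add,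
        pivotProj_mul_self, ← Matrix.mul_assoc, hWΓ]
    set Z := S' * (M' * pivotProj R) with hZdef
    have hMRZ : M * R * Z = pivotProj R := by
      rw [Matrix.mul_assoc, hRZ, ← Matrix.mul_assoc, hM1, Matrix.one_mul]
    have hpsd := hFp.conjTranspose_mul_mul_same Z
    have hform : Zᴴ * (K - X - Xᴴ) * Z = pivotProj R - Γᴴ * Γ := by
      rw [← hF, psdParam, Matrix.inv_eq_right_inv hinv]
      calc Zᴴ * (Rᴴ * Mᴴ * (1 - Γᴴ * Γ) * M * R) * Z
          = (M * R * Z)ᴴ * (1 - Γᴴ * Γ) * (M * R * Z) := by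
            simp only [Matrix.conjTranspose_mul, Matrix.mul_assoc]
        _ = pivotProj R * pivotProj R - (Γ * pivotProj R)ᴴ * (Γ * pivotProj R) := by
            rw [hMRZ, Matrix.conjTranspose_mul Γ, pivotProj_conjTranspose, Matrix.mul_sub,
              Matrix.sub_mul, Matrix.mul_one]
            simp only [Matrix.mul_assoc]
        _ = _ := by rw [pivotProj_mul_self, hΓR]
    rw [hform] at hpsd
    -- Adding the complementary projection upgrades $P_R-\Gamma^*\Gamma\succeq0$ to
    -- $I-\Gamma^*\Gamma\succeq0$.
    have hcompl : ((1 - pivotProj R)ᴴ * (1 - pivotProj R)).PosSemidef :=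
      Matrix.posSemidef_conjTranspose_mul_self _
    have hsq : (1 - pivotProj R)ᴴ * (1 - pivotProj R) = 1 - pivotProj R := by
      rw [Matrix.conjTranspose_sub, Matrix.conjTranspose_one, pivotProj_conjTranspose,
        Matrix.sub_mul, Matrix.one_mul, Matrix.mul_sub, Matrix.mul_one, pivotProj_mul_self,
        sub_self, sub_zero]
    rw [hsq] at hcompl
    have := hcompl.add hpsd
    rwa [sub_add_sub_cancel] at this

end Bijection


/-! ### Schur residuals -/

section SchurResidual

/-- In a semidefinite block matrix the range of $B$ lies in that of $A$: with $E=I-AA^+$ the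
quadratic form vanishes on the columns of $E$ padded by zero, so the block matrix kills them and
$B^*E=0$. -/
theorem mul_pinv_mul_of_posSemidef {m o : Type*} [Fintype m] [DecidableEq m] [Fintype o]
    [DecidableEq o] {A : Matrix m m ℂ} {B : Matrix m o ℂ} {D : Matrix o o ℂ}
    (h : (Matrix.fromBlocks A B Bᴴ D).PosSemidef) : A * (pinv A * B) = B := by
  obtain ⟨h1, -, h3, -⟩ := pinv_spec A
  have hA : Aᴴ = A := (Matrix.isHermitian_fromBlocks_iff.mp h.1).1
  set E : Matrix m m ℂ := 1 - A * pinv A with hE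
  have hEA : Eᴴ * A = 0 := by
    rw [hE, Matrix.conjTranspose_sub, Matrix.conjTranspose_one, h3, Matrix.sub_mul, Matrix.one_mul,
      h1, sub_self]
  have hAE : A * E = 0 := by
    rw [← Matrix.conjTranspose_conjTranspose (A * E), Matrix.conjTranspose_mul, hA, hEA,
      Matrix.conjTranspose_zero]
  obtain ⟨C, hC⟩ := CStarAlgebra.nonneg_iff_eq_star_mul_self.mp h.nonneg
  set N : Matrix (m ⊕ o) m ℂ := Matrix.fromRows E 0 with hN
  have hMN : Matrix.fromBlocks A B Bᴴ D * N = Matrix.fromRows 0 (Bᴴ * E) := by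
    rw [hN, Matrix.fromBlocks_mul_fromRows, hAE, Matrix.mul_zero, Matrix.mul_zero, add_zero,
      add_zero]
  have hNN : Nᴴ * (Matrix.fromBlocks A B Bᴴ D * N) = 0 := by
    rw [hMN, hN, Matrix.conjTranspose_fromRows_eq_fromCols_conjTranspose,
      Matrix.fromCols_mul_fromRows, Matrix.mul_zero, Matrix.conjTranspose_zero, Matrix.zero_mul,
      add_zero]
  have hCN : C * N = 0 := by
    rw [← Matrix.conjTranspose_mul_self_eq_zero, Matrix.conjTranspose_mul, Matrix.mul_assoc,
      ← Matrix.mul_assoc Cᴴ]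
    rw [hC] at hNN
    exact hNN
  have hBE : Bᴴ * E = 0 := by
    have h0 : Matrix.fromRows (0 : Matrix m m ℂ) (Bᴴ * E) = 0 := by
      rw [← hMN, hC, Matrix.star_eq_conjTranspose, Matrix.mul_assoc, hCN, Matrix.mul_zero]
    rw [← Matrix.fromRows_zero] at h0
    exact (Matrix.fromRows_inj h0).2
  have hEB : Eᴴ * B = 0 := by
    rw [← Matrix.conjTranspose_conjTranspose (Eᴴ * B), Matrix.conjTranspose_mul,
      Matrix.conjTranspose_conjTranspose, hBE, Matrix.conjTranspose_zero]
  rw [hE, Matrix.conjTranspose_sub, Matrix.conjTranspose_one, h3, Matrix.sub_mul, Matrix.one_mul,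
    Matrix.mul_assoc] at hEB
  exact (sub_eq_zero.mp hEB).symm

variable {n : ℕ}

/-- The vector `e_v - c`, where `c` is supported on `p` and solves `K[p] c = K[p, v]`. -/
noncomputable def schurResidual (K : Matrix (Fin n) (Fin n) ℂ) (p : Fin n → Prop)
    [DecidablePred p] (v : Fin n) : Fin n → ℂ :=
  Pi.single v 1 - fun i => if h : p i then
    (pinv (K.submatrix (Subtype.val : {i // p i} → Fin n) Subtype.val) *ᵥ fun y => K y.1 v) ⟨i, h⟩
    else 0

theorem mulVec_schurResidual (K : Matrix (Fin n) (Fin n) ℂ) (p : Fin n → Prop) [DecidablePred p]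
    (v w : Fin n) :
    (K *ᵥ schurResidual K p v) w = K w v
      - (K.submatrix id (Subtype.val : {i // p i} → Fin n)
        * pinv (K.submatrix (Subtype.val : {i // p i} → Fin n) Subtype.val)
        * K.submatrix (Subtype.val : {i // p i} → Fin n) id) w v := by
  rw [schurResidual, Matrix.mulVec_sub, Pi.sub_apply, Matrix.mulVec_single_one, Matrix.mul_assoc]
  congr 1
  rw [Matrix.mul_apply]
  change ∑ i, K w i * (if h : p i then
      (pinv (K.submatrix (Subtype.val : {i // p i} → Fin n) Subtype.val) *ᵥ
        fun y => K y.1 v) ⟨i, h⟩ else 0) = _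
  rw [← Fintype.sum_subtype_add_sum_subtype p]
  have h0 : ∑ i : {i // ¬p i}, K w i.1 * (if h : p i.1 then
      (pinv (K.submatrix (Subtype.val : {i // p i} → Fin n) Subtype.val) *ᵥ
        fun y => K y.1 v) ⟨i.1, h⟩ else 0) = 0 :=
    Finset.sum_eq_zero fun i _ => by rw [dif_neg i.2, mul_zero]
  rw [h0, add_zero]
  exact Finset.sum_congr rfl fun i _ => by rw [dif_pos i.2]; rfl

theorem schurResidual_apply_self {K : Matrix (Fin n) (Fin n) ℂ} {p : Fin n → Prop}
    [DecidablePred p] {v : Fin n} (hv : ¬p v) : schurResidual K p v v = 1 := by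
  rw [schurResidual, Pi.sub_apply, Pi.single_eq_same, dif_neg hv, sub_zero]

theorem schurResidual_supp {K : Matrix (Fin n) (Fin n) ℂ} {p : Fin n → Prop} [DecidablePred p]
    {v i : Fin n} (h : schurResidual K p v i ≠ 0) : i = v ∨ p i := by
  by_contra hi
  push Not at hi
  exact h (by rw [schurResidual, Pi.sub_apply, Pi.single_eq_of_ne hi.1, dif_neg hi.2, sub_zero])

theorem mulVec_schurResidual_eq_zero {K : Matrix (Fin n) (Fin n) ℂ} {p : Fin n → Prop}
    [DecidablePred p] {v w : Fin n} (hK : K.IsHermitian) {s : Finset (Fin n)}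
    (hs : (K.submatrix (Subtype.val : s → Fin n) Subtype.val).PosSemidef)
    (hp : ∀ i, p i → i ∈ s) (hv : v ∈ s) (hw : p w) : (K *ᵥ schurResidual K p v) w = 0 := by
  have h := hs.submatrix (Sum.elim (fun i : {i // p i} => (⟨i.1, hp i.1 i.2⟩ : s))
    (fun _ : Unit => ⟨v, hv⟩))
  have hb : (Matrix.fromBlocks (K.submatrix (Subtype.val : {i // p i} → Fin n) Subtype.val)
      (K.submatrix (Subtype.val : {i // p i} → Fin n) fun _ : Unit => v)
      (K.submatrix (Subtype.val : {i // p i} → Fin n) fun _ : Unit => v)ᴴ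
      (K.submatrix (fun _ : Unit => v) fun _ : Unit => v)).PosSemidef := by
    convert h using 1
    ext i j
    rcases i with i | i <;> rcases j with j | j
    · rfl
    · rfl
    · exact hK.apply _ _
    · rfl
  have := congrFun (congrFun (mul_pinv_mul_of_posSemidef hb) ⟨w, hw⟩) ()
  rw [mulVec_schurResidual, sub_eq_zero, Matrix.mul_assoc]
  exact this.symm

end SchurResidual

/-! ### Existence of adapted bases and of Cholesky factors -/

section Existence

variable {n : ℕ} {G : SimpleGraph (Fin n)} {K U : Matrix (Fin n) (Fin n) ℂ}

theorem isClique_neighbors_ge (hG : IsBanded G) (l : Fin n)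
    (s : Finset (Fin n)) (hs : ∀ i ∈ s, l ≤ i ∧ InPattern G l i) : G.IsClique (s : Set (Fin n)) := by
  intro i hi j hj hij
  rcases lt_or_gt_of_ne hij with h | h
  · exact ((hs j hj).2.of_le hG (hs i hi).1 h.le le_rfl).resolve_left hij
  · exact (((hs i hi).2.of_le hG (hs j hj).1 h.le le_rfl).resolve_left hij.symm).symm

/-- A Hermitian matrix with positive semidefinite clique submatrices has an adapted basis as soon
as each off-pattern position `(l, v)` is explained by the vertices between `l` and `v`. -/
theorem exists_adaptedBasis (hG : IsBanded G) (hK : K.IsHermitian)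
    (hcl : ∀ s : Finset (Fin n), G.IsClique (s : Set (Fin n)) →
      (K.submatrix (Subtype.val : s → Fin n) Subtype.val).PosSemidef)
    (hM : ∀ l v, l < v → ¬InPattern G l v → ∃ z : Fin n → ℂ, z v = 1 ∧
      (∀ i, z i ≠ 0 → l < i ∧ i ≤ v) ∧ ∀ w, l ≤ w → InPattern G l w → (K *ᵥ z) w = 0) :
    ∃ U, IsAdaptedBasis G K U := by
  classical
  have hcol : ∀ l, ∃ u : Fin n → ℂ, u l = 1 ∧ (∀ i, u i ≠ 0 → l ≤ i ∧ InPattern G l i) ∧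
      ∀ v, l < v → (K *ᵥ u) v = 0 := by
    intro l
    set s : Finset (Fin n) := Finset.univ.filter fun i => l ≤ i ∧ InPattern G l i with hs
    have hmem : ∀ i, i ∈ s ↔ l ≤ i ∧ InPattern G l i := fun i => by simp [hs]
    have hps := hcl s (isClique_neighbors_ge hG l s fun i hi => (hmem i).mp hi)
    -- Eliminating $e_l$ against the later neighbours of $l$ makes $Ku$ vanish at those neighbours;
    -- the remaining $v>l$ are treated by induction.
    set u := schurResidual K (fun i => l < i ∧ InPattern G l i) l with hu
    have hsupp : ∀ i, u i ≠ 0 → l ≤ i ∧ InPattern G l i := by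
      intro i hi
      rcases schurResidual_supp hi with rfl | h
      · exact ⟨le_rfl, Or.inl rfl⟩
      · exact ⟨h.1.le, h.2⟩
    refine ⟨u, schurResidual_apply_self (fun h => lt_irrefl _ h.1), hsupp, fun v => ?_⟩
    induction v using WellFoundedLT.induction with
    | ind v ih =>
      intro hlv
      by_cases hp : InPattern G l v
      · exact mulVec_schurResidual_eq_zero hK hps
          (fun i hi => (hmem i).mpr ⟨hi.1.le, hi.2⟩) ((hmem l).mpr ⟨le_rfl, Or.inl rfl⟩) ⟨hlv, hp⟩
      · obtain ⟨z, hz1, hz2, hz3⟩ := hM l v hlv hp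
        -- By symmetry $z^*Ku=(Kz)^*u$, and $Kz$ vanishes on the support of $u$. Read the other way,
        -- the induction hypothesis removes all terms but $(Ku)_v$.
        have h0 : star z ⬝ᵥ (K *ᵥ u) = 0 := by
          rw [Matrix.dotProduct_mulVec]
          have : star z ᵥ* K = star (K *ᵥ z) := by rw [Matrix.star_mulVec, hK.eq]
          rw [this]
          refine Finset.sum_eq_zero fun w _ => ?_
          by_cases hw : u w = 0
          · rw [hw, mul_zero]
          · rw [Pi.star_apply, hz3 w (hsupp w hw).1 (hsupp w hw).2, star_zero, zero_mul]
        rw [dotProduct, Finset.sum_eq_single v, Pi.star_apply, hz1, star_one, one_mul] at h0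
        · exact h0
        · intro i _ hiv
          by_cases hi : z i = 0
          · rw [Pi.star_apply, hi, star_zero, zero_mul]
          · rw [ih i (lt_of_le_of_ne (hz2 i hi).2 hiv) (hz2 i hi).1, mul_zero]
        · exact fun h => absurd (Finset.mem_univ v) h
  choose u hu1 hu2 hu3 using hcol
  exact ⟨Matrix.of fun i l => u l i, ⟨hu1, fun i j h => hu2 j i h, fun i j hij => hu3 j i hij⟩⟩

/-- $U^*KU$ is Hermitian and upper triangular, hence diagonal. Its entries are nonnegative because
each column of $U$ lives on a clique, so $L=\sqrt D\,U^{-1}$ works. Semidefiniteness of $K$ is a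
consequence and not an assumption. -/
theorem IsAdaptedBasis.exists_lowerCholesky (hG : IsBanded G) (hU : IsAdaptedBasis G K U)
    (hK : K.IsHermitian)
    (hcl : ∀ s : Finset (Fin n), G.IsClique (s : Set (Fin n)) →
      (K.submatrix (Subtype.val : s → Fin n) Subtype.val).PosSemidef) :
    ∃ L, IsLowerCholesky K L := by
  classical
  have hherm : (Uᴴ * (K * U)).IsHermitian := by
    rw [← Matrix.mul_assoc]; exact Matrix.isHermitian_conjTranspose_mul_mul U hK
  have hup : (Uᴴ * (K * U)).IsUpperTriangular :=
    (IsLowerTriangular.conjTranspose hU.lower).mul hU.upper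
  have hnonneg : ∀ l, 0 ≤ (Uᴴ * (K * U)) l l := by
    intro l
    set s : Finset (Fin n) := Finset.univ.filter fun i => l ≤ i ∧ InPattern G l i with hs
    have hmem : ∀ i, i ∈ s ↔ l ≤ i ∧ InPattern G l i := fun i => by simp [hs]
    have hzero : ∀ i, i ∉ s → U i l = 0 := fun i hi => by
      by_contra h; exact hi ((hmem i).mpr (hU.supp i l h))
    have hsum : ∀ f : Fin n → ℂ, (∀ i, i ∉ s → f i = 0) → ∑ i, f i = ∑ i : s, f i.1 := fun f hf => by
      rw [Finset.sum_coe_sort s f]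
      exact (Finset.sum_subset (Finset.subset_univ s) fun i _ hi => hf i hi).symm
    have hps := (hcl s (isClique_neighbors_ge hG l s fun i hi => (hmem i).mp hi)
      ).dotProduct_mulVec_nonneg fun i => U i.1 l
    convert hps using 1
    rw [Matrix.mul_apply, hsum _ fun i hi => by
      rw [Matrix.conjTranspose_apply, hzero i hi, star_zero, zero_mul]]
    refine Finset.sum_congr rfl fun i _ => ?_
    rw [Matrix.mul_apply, hsum _ fun j hj => by rw [hzero j hj, mul_zero]]
    rfl
  set d : Fin n → ℝ := fun l => ((Uᴴ * (K * U)) l l).re with hd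
  have hdc : ∀ l, (Uᴴ * (K * U)) l l = (d l : ℂ) := fun l =>
    Complex.ext rfl (Complex.nonneg_iff.mp (hnonneg l)).2.symm
  have hdpos : ∀ l, 0 ≤ d l := fun l => (Complex.nonneg_iff.mp (hnonneg l)).1
  have hD : Uᴴ * (K * U) = Matrix.diagonal fun l => (d l : ℂ) := by
    ext i j
    rcases lt_trichotomy i j with hij | rfl | hij
    · rw [Matrix.diagonal_apply_ne _ hij.ne, ← hherm.apply, hup (i := j) (j := i) hij, star_zero]
    · rw [Matrix.diagonal_apply_eq, hdc]
    · rw [Matrix.diagonal_apply_ne _ hij.ne', hup (i := i) (j := j) hij]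
  obtain ⟨U', h1, h2, hU'⟩ := BlockTriangular.exists_inverse hU.lower hU.isUnit
  have hdiag : ∀ i, U' i i ≠ 0 := by
    intro i h
    have := congrFun (congrFun h1 i) i
    rw [Matrix.mul_apply, Matrix.one_apply_eq, Finset.sum_eq_single i, h, mul_zero] at this
    · exact zero_ne_one this
    · intro k _ hk
      rcases lt_or_gt_of_ne hk with hk | hk
      · rw [hU' (i := k) (j := i) hk, mul_zero]
      · rw [hU.lower (i := i) (j := k) hk, zero_mul]
    · exact fun h => absurd (Finset.mem_univ i) h
  refine ⟨Matrix.diagonal (fun l => ((Real.sqrt (d l) : ℝ) : ℂ)) * U', fun i j hij => ?_, ?_,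
    fun i hi j => ?_⟩
  · rw [Matrix.diagonal_mul, hU' (i := i) (j := j) hij, mul_zero]
  · have hsq : (Matrix.diagonal fun l => ((Real.sqrt (d l) : ℝ) : ℂ))ᴴ
        * (Matrix.diagonal fun l => ((Real.sqrt (d l) : ℝ) : ℂ))
        = Matrix.diagonal fun l => (d l : ℂ) := by
      rw [Matrix.diagonal_conjTranspose, Matrix.diagonal_mul_diagonal]
      congr 1
      funext l
      rw [Pi.star_apply, Complex.star_def, Complex.conj_ofReal, ← Complex.ofReal_mul,
        Real.mul_self_sqrt (hdpos l)]
    rw [Matrix.conjTranspose_mul, Matrix.mul_assoc, ← Matrix.mul_assoc _ _ U', hsq, ← hD]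
    have h3 : U'ᴴ * Uᴴ = 1 := by
      rw [← Matrix.conjTranspose_mul, h1, Matrix.conjTranspose_one]
    calc K = (U'ᴴ * Uᴴ) * K * (U * U') := by rw [h3, h1, Matrix.one_mul, Matrix.mul_one]
      _ = _ := by simp only [Matrix.mul_assoc]
  · rw [Matrix.diagonal_mul] at hi ⊢
    rw [(mul_eq_zero.mp hi).resolve_right (hdiag i), zero_mul]

/-- For the complete graph there are no off-pattern positions, and the adapted basis is ordinary
elimination. -/
theorem exists_lowerCholesky (hK : K.PosSemidef) : ∃ L, IsLowerCholesky K L := by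
  have hG : IsBanded (⊤ : SimpleGraph (Fin n)) := fun _ _ _ _ i j _ hij _ => hij.ne
  have hcl : ∀ s : Finset (Fin n), (⊤ : SimpleGraph (Fin n)).IsClique (s : Set (Fin n)) →
      (K.submatrix (Subtype.val : s → Fin n) Subtype.val).PosSemidef :=
    fun s _ => hK.submatrix _
  obtain ⟨U, hU⟩ := exists_adaptedBasis hG hK.1 hcl fun l v hlv hp =>
    absurd (Or.inr hlv.ne : InPattern ⊤ l v) hp
  exact hU.exists_lowerCholesky hG hK.1 hcl

theorem exists_upperCholesky (hK : K.PosSemidef) : ∃ R, IsUpperCholesky K R := by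
  obtain ⟨L, h1, h2, h3⟩ := exists_lowerCholesky (hK.submatrix (Fin.rev : Fin n → Fin n))
  refine ⟨L.submatrix Fin.rev Fin.rev, fun i j hij => h1 _ _ (Fin.rev_lt_rev.mpr hij), ?_,
    fun i hi j => h3 _ hi _⟩
  rw [Matrix.conjTranspose_submatrix, Matrix.submatrix_mul _ _ _ _ _ Fin.rev_bijective |>.symm, ← h2]
  ext i j
  simp

/-- Equal Gram matrices make $Lx\mapsto Rx$ a well-defined isometry on $\operatorname{ran}L$, given
by $RL^+$; in finite dimension it extends to the whole space. -/
theorem exists_unitary_mul_eq {R L : Matrix (Fin n) (Fin n) ℂ} (h : Rᴴ * R = Lᴴ * L) :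
    ∃ W ∈ Matrix.unitaryGroup (Fin n) ℂ, R = W * L := by
  obtain ⟨hP, -, -, -⟩ := pinv_spec L
  have hnorm : ∀ x : Fin n → ℂ, ‖WithLp.toLp 2 (R *ᵥ x)‖ = ‖WithLp.toLp 2 (L *ᵥ x)‖ := by
    intro x
    have : ((‖WithLp.toLp 2 (R *ᵥ x)‖ ^ 2 : ℝ) : ℂ) = ((‖WithLp.toLp 2 (L *ᵥ x)‖ ^ 2 : ℝ) : ℂ) := by
      rw [← star_dotProduct_self_eq_norm_sq, ← star_dotProduct_self_eq_norm_sq, Matrix.star_mulVec,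
        Matrix.star_mulVec, ← Matrix.dotProduct_mulVec, ← Matrix.dotProduct_mulVec,
        Matrix.mulVec_mulVec, Matrix.mulVec_mulVec, h]
    exact (pow_left_inj₀ (norm_nonneg _) (norm_nonneg _) two_ne_zero).mp (Complex.ofReal_inj.mp this)
  have hRP : R * (pinv L * L) = R := by
    have h0 : L * (pinv L * L - 1) = 0 := by
      rw [Matrix.mul_sub, ← Matrix.mul_assoc, hP, Matrix.mul_one, sub_self]
    have h1 : R * (pinv L * L - 1) = 0 := by
      rw [← Matrix.conjTranspose_mul_self_eq_zero, Matrix.conjTranspose_mul, Matrix.mul_assoc,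
        ← Matrix.mul_assoc Rᴴ, h, Matrix.mul_assoc Lᴴ, h0, Matrix.mul_zero, Matrix.mul_zero]
    rw [Matrix.mul_sub, Matrix.mul_one] at h1
    exact sub_eq_zero.mp h1
  let S := LinearMap.range (Matrix.toEuclideanLin L)
  let f : S →ₗᵢ[ℂ] EuclideanSpace ℂ (Fin n) :=
    { toLinearMap := (Matrix.toEuclideanLin (R * pinv L)).domRestrict S
      norm_map' := by
        rintro ⟨_, x, rfl⟩
        have : (Matrix.toEuclideanLin (R * pinv L)) (Matrix.toEuclideanLin L x)
            = WithLp.toLp 2 (R *ᵥ WithLp.ofLp x) := by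
          change WithLp.toLp 2 ((R * pinv L) *ᵥ (L *ᵥ WithLp.ofLp x)) = _
          rw [Matrix.mulVec_mulVec, Matrix.mul_assoc, hRP]
        change ‖(Matrix.toEuclideanLin (R * pinv L)) (Matrix.toEuclideanLin L x)‖ = _
        rw [this, hnorm]
        rfl }
  let g := f.extend
  set W : Matrix (Fin n) (Fin n) ℂ := Matrix.toEuclideanLin.symm g.toLinearMap with hWdef
  have hW : ∀ x : Fin n → ℂ, WithLp.toLp 2 (W *ᵥ x) = g (WithLp.toLp 2 x) := by
    intro x
    have : Matrix.toEuclideanLin W = g.toLinearMap := LinearEquiv.apply_symm_apply _ _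
    exact congrArg (fun t : EuclideanSpace ℂ (Fin n) →ₗ[ℂ] EuclideanSpace ℂ (Fin n) =>
      t (WithLp.toLp 2 x)) this
  have hq : ∀ x, star x ⬝ᵥ ((1 - Wᴴ * W) *ᵥ x) = 0 := by
    intro x
    rw [dotProduct_one_sub_conjTranspose_mul_self, hW, g.norm_map, sub_self, Complex.ofReal_zero]
  have hpsd : (1 - Wᴴ * W).PosSemidef := Matrix.PosSemidef.of_dotProduct_mulVec_nonneg
    (Matrix.isHermitian_one.sub (Matrix.isHermitian_conjTranspose_mul_self W))
    fun x => (hq x).ge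
  have hWW : Wᴴ * W = 1 := by
    have : 1 - Wᴴ * W = 0 := by
      refine Matrix.ext_of_mulVec_single fun i => ?_
      rw [(hpsd.dotProduct_mulVec_zero_iff _).mp (hq _), Matrix.zero_mulVec]
    exact (sub_eq_zero.mp this).symm
  refine ⟨W, Matrix.mem_unitaryGroup_iff'.mpr hWW, ?_⟩
  refine Matrix.ext_of_mulVec_single fun i => ?_
  have h1 : WithLp.toLp 2 (W *ᵥ (L *ᵥ Pi.single i 1))
      = WithLp.toLp 2 ((R * pinv L) *ᵥ (L *ᵥ Pi.single i 1)) := by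
    rw [hW]
    exact f.extend_apply ⟨_, WithLp.toLp 2 (Pi.single i 1), rfl⟩
  rw [← Matrix.mulVec_mulVec, (WithLp.toLp_injective 2) h1, Matrix.mulVec_mulVec, Matrix.mul_assoc,
    hRP]

end Existence


/-! ### The staircase algorithm -/

section Staircase

variable {n : ℕ} {G : SimpleGraph (Fin n)}

theorem le_lastNeighbor {v w : Fin n} (h : InPattern G v w) :
    w.val + 1 ≤ lastNeighbor G (v.val + 1) := by
  classical
  refine Finset.le_sup (f := fun j : Fin n => j.val + 1) ?_
  simp only [Finset.mem_filter, Finset.mem_univ, true_and]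
  exact ⟨v, rfl, h⟩

theorem exists_eq_lastNeighbor (G : SimpleGraph (Fin n)) (v : Fin n) :
    ∃ w, v ≤ w ∧ InPattern G v w ∧ lastNeighbor G (v.val + 1) = w.val + 1 := by
  classical
  have hself := le_lastNeighbor (Or.inl rfl : InPattern G v v)
  obtain ⟨w, hw, he⟩ := Finset.exists_mem_eq_sup
    (Finset.univ.filter fun j : Fin n => ∃ v' : Fin n, v'.val + 1 = v.val + 1 ∧ InPattern G v' j)
    ⟨v, by simpa using ⟨v, rfl, Or.inl rfl⟩⟩ (fun j => j.val + 1)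
  simp only [Finset.mem_filter, Finset.mem_univ, true_and] at hw
  obtain ⟨v', hv', hp⟩ := hw
  obtain rfl : v' = v := Fin.ext (by omega)
  have he' : lastNeighbor G (v'.val + 1) = w.val + 1 := by
    rw [← he, lastNeighbor]
  exact ⟨w, Fin.le_def.mpr (by omega), hp, he'⟩

theorem inPattern_of_le_lastNeighbor (hG : IsBanded G) {v w : Fin n} (hvw : v ≤ w)
    (h : w.val + 1 ≤ lastNeighbor G (v.val + 1)) : InPattern G v w := by
  obtain ⟨j, -, hp, he⟩ := exists_eq_lastNeighbor G v
  exact hp.of_le hG le_rfl hvw (Fin.le_def.mpr (by omega))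

theorem lastNeighbor_zero (G : SimpleGraph (Fin n)) : lastNeighbor G 0 = 0 := by
  classical
  rw [lastNeighbor, Finset.filter_false_of_mem, Finset.sup_empty]
  · rfl
  · rintro j - ⟨v, hv, -⟩
    omega

theorem le_lastNeighbor_self (G : SimpleGraph (Fin n)) {m : ℕ} (h1 : 1 ≤ m) (hn : m ≤ n) :
    m ≤ lastNeighbor G m := by
  have := le_lastNeighbor (Or.inl rfl : InPattern G (⟨m - 1, by omega⟩ : Fin n) ⟨m - 1, by omega⟩)
  simpa only [Nat.sub_add_cancel h1] using this

theorem lastNeighbor_mono (hG : IsBanded G) {a b : ℕ} (h1 : 1 ≤ a) (hab : a ≤ b) (hn : b ≤ n) :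
    lastNeighbor G a ≤ lastNeighbor G b := by
  have hb := le_lastNeighbor_self G (h1.trans hab) hn
  obtain ⟨w, hw, hp, he⟩ := exists_eq_lastNeighbor G (⟨a - 1, by omega⟩ : Fin n)
  simp only [Nat.sub_add_cancel h1] at he
  rcases le_or_gt (w.val + 1) b with h | h
  · omega
  · have := le_lastNeighbor (hp.of_le hG (k := ⟨b - 1, by omega⟩) (l := w)
      (Fin.le_def.mpr (by change a - 1 ≤ b - 1; omega))
      (Fin.le_def.mpr (by change b - 1 ≤ w.val; omega)) le_rfl)
    simp only [Nat.sub_add_cancel (h1.trans hab)] at this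
    omega

theorem not_inPattern_of_lastNeighbor_lt (hG : IsBanded G) {u v : Fin n} {m : ℕ} (hn : m ≤ n)
    (hu : u.val + 1 ≤ m) (hv : lastNeighbor G m < v.val + 1) : ¬InPattern G u v := fun h => by
  have h1 := le_lastNeighbor h
  have h2 := lastNeighbor_mono hG (Nat.le_add_left 1 u.val) hu hn
  omega

variable {M : Matrix (Fin n) (Fin n) ℂ}

theorem staircaseFill_apply_of_not {x y z : ℕ} {u v : Fin n} (h1 : ¬(u.val + 1 < x ∧ y < v.val + 1))
    (h2 : ¬(v.val + 1 < x ∧ y < u.val + 1)) : staircaseFill x y z M u v = M u v := by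
  rw [staircaseFill]
  simp only []
  rw [if_neg fun h => h1 ⟨h.1, h.2.1⟩, if_neg fun h => h2 ⟨h.1, h.2.1⟩]

theorem staircaseFill_apply {x y z : ℕ} {u v : Fin n} (h1 : u.val + 1 < x) (h2 : y < v.val + 1)
    (h3 : v.val + 1 ≤ z) : staircaseFill x y z M u v =
      (M.submatrix id (Subtype.val : {i : Fin n // x ≤ i.val + 1 ∧ i.val + 1 ≤ y} → Fin n) *
        pinv (M.submatrix (Subtype.val : {i : Fin n // x ≤ i.val + 1 ∧ i.val + 1 ≤ y} → Fin n)
          Subtype.val) *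
        M.submatrix (Subtype.val : {i : Fin n // x ≤ i.val + 1 ∧ i.val + 1 ≤ y} → Fin n) id) u v := by
  rw [staircaseFill]
  simp only []
  rw [if_pos ⟨h1, h2, h3⟩]

/-- The bound on `x` keeps the two filled regions disjoint, so the order of the two cases is
immaterial. -/
theorem staircaseFill_isHermitian {x y z : ℕ} (hxy : x ≤ y + 1) (hM : M.IsHermitian) :
    (staircaseFill x y z M).IsHermitian := by
  ext u v
  rw [Matrix.conjTranspose_apply]
  rw [staircaseFill]
  simp only []
  by_cases h1 : v.val + 1 < x ∧ y < u.val + 1 ∧ u.val + 1 ≤ z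
  · rw [if_pos h1, if_neg (fun h => by omega), if_pos h1]
  · by_cases h2 : u.val + 1 < x ∧ y < v.val + 1 ∧ v.val + 1 ≤ z
    · rw [if_neg h1, if_pos h2, if_pos h2, star_star]
    · rw [if_neg h1, if_neg h2, if_neg h2, if_neg h1]
      exact hM.apply u v

theorem staircaseLoop_succ (M : Matrix (Fin n) (Fin n) ℂ) (i : ℕ) :
    staircaseLoop G M (i + 1) =
      if lastNeighbor G i < lastNeighbor G (i + 1) ∧ 2 ≤ i + 1 then
        (i + 1, staircaseFill (i + 1) (lastNeighbor G (staircaseLoop G M i).1)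
          (lastNeighbor G (i + 1)) (staircaseLoop G M i).2)
      else staircaseLoop G M i := rfl

theorem staircaseLoop_one (M : Matrix (Fin n) (Fin n) ℂ) : staircaseLoop G M 1 = (1, M) := by
  rw [staircaseLoop_succ, if_neg (fun h => by omega)]
  rfl

/-- The stored index may lag behind the pass, but passes are skipped only while $J$ stays constant.
-/
theorem lastNeighbor_staircaseLoop_fst (hG : IsBanded G) (M : Matrix (Fin n) (Fin n) ℂ) {m : ℕ}
    (h1 : 1 ≤ m) (hn : m ≤ n) : lastNeighbor G (staircaseLoop G M m).1 = lastNeighbor G m := by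
  induction m, h1 using Nat.le_induction with
  | base => rw [staircaseLoop_one]
  | succ m hm ih =>
    rw [staircaseLoop_succ]
    split_ifs with h
    · rfl
    · rw [ih (by omega)]
      have := lastNeighbor_mono hG hm (Nat.le_succ m) hn
      rw [Nat.succ_eq_add_one] at this
      omega

theorem staircaseLoop_succ_snd (hG : IsBanded G) (M : Matrix (Fin n) (Fin n) ℂ) {m : ℕ}
    (h1 : 1 ≤ m) (hn : m + 1 ≤ n) : (staircaseLoop G M (m + 1)).2 =
      if lastNeighbor G m < lastNeighbor G (m + 1) then
        staircaseFill (m + 1) (lastNeighbor G m) (lastNeighbor G (m + 1)) (staircaseLoop G M m).2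
      else (staircaseLoop G M m).2 := by
  rw [staircaseLoop_succ, lastNeighbor_staircaseLoop_fst hG M h1 (by omega)]
  by_cases h : lastNeighbor G m < lastNeighbor G (m + 1)
  · rw [if_pos h, if_pos ⟨h, by omega⟩]
  · rw [if_neg h, if_neg fun h' => h h'.1]

theorem staircaseLoop_apply_of_inPattern (hG : IsBanded G) (M : Matrix (Fin n) (Fin n) ℂ)
    {u v : Fin n} (huv : InPattern G u v) {m : ℕ} (h1 : 1 ≤ m) (hn : m ≤ n) :
    (staircaseLoop G M m).2 u v = M u v := by
  induction m, h1 using Nat.le_induction with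
  | base => rw [staircaseLoop_one]
  | succ m hm ih =>
    rw [staircaseLoop_succ_snd hG M hm hn, ← ih (by omega)]
    split_ifs with h
    · refine staircaseFill_apply_of_not (fun h => ?_) fun h => ?_
      · exact not_inPattern_of_lastNeighbor_lt hG (by omega) (Nat.lt_succ_iff.mp h.1) h.2 huv
      · exact not_inPattern_of_lastNeighbor_lt hG (by omega) (Nat.lt_succ_iff.mp h.1) h.2 huv.symm
    · rfl

/-- Later passes write only in rows or columns beyond $J(m)$, so the leading block of that size is
final. -/
theorem staircaseLoop_apply_stable (hG : IsBanded G) (M : Matrix (Fin n) (Fin n) ℂ) {u v : Fin n}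
    {m m' : ℕ} (h1 : 1 ≤ m) (hm : m ≤ m') (hn : m' ≤ n) (hu : u.val + 1 ≤ lastNeighbor G m)
    (hv : v.val + 1 ≤ lastNeighbor G m) :
    (staircaseLoop G M m').2 u v = (staircaseLoop G M m).2 u v := by
  induction m', hm using Nat.le_induction with
  | base => rfl
  | succ m' hm ih =>
    have hJ := lastNeighbor_mono hG h1 hm (by omega)
    rw [staircaseLoop_succ_snd hG M (h1.trans hm) hn, ← ih (by omega)]
    split_ifs with h
    · exact staircaseFill_apply_of_not (fun h => by omega) fun h => by omega
    · rfl

theorem staircaseLoop_isHermitian (hG : IsBanded G) (hM : M.IsHermitian) {m : ℕ} (h1 : 1 ≤ m)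
    (hn : m ≤ n) : (staircaseLoop G M m).2.IsHermitian := by
  induction m, h1 using Nat.le_induction with
  | base => rwa [staircaseLoop_one]
  | succ m hm ih =>
    rw [staircaseLoop_succ_snd hG M hm hn]
    split_ifs with h
    · refine staircaseFill_isHermitian ?_ (ih (by omega))
      have := le_lastNeighbor_self G hm (by omega)
      omega
    · exact ih (by omega)

/-- The rows above a staircase step are Schur orthogonal to the columns filled in this step. -/
theorem staircaseLoop_mulVec_schurResidual (hG : IsBanded G) (M : Matrix (Fin n) (Fin n) ℂ)
    {m : ℕ} (h1 : 1 ≤ m) (hn : m + 1 ≤ n) {u v : Fin n} (hu : u.val + 1 ≤ m)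
    (hv : lastNeighbor G m < v.val + 1) (hv' : v.val + 1 ≤ lastNeighbor G (m + 1)) :
    ((staircaseLoop G M n).2 *ᵥ schurResidual (staircaseLoop G M n).2
      (fun i => m + 1 ≤ i.val + 1 ∧ i.val + 1 ≤ lastNeighbor G m) v) u = 0 := by
  have hm := le_lastNeighbor_self G h1 (by omega)
  have hlt : lastNeighbor G m < lastNeighbor G (m + 1) := by omega
  rw [mulVec_schurResidual, sub_eq_zero,
    staircaseLoop_apply_stable hG M (Nat.le_add_left 1 m) hn le_rfl (by omega) hv',
    staircaseLoop_succ_snd hG M h1 hn, if_pos hlt, staircaseFill_apply (by omega) hv hv']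
  have hrow : ∀ i j : Fin n, i.val + 1 ≤ lastNeighbor G m → j.val + 1 ≤ lastNeighbor G m →
      (staircaseLoop G M n).2 i j = (staircaseLoop G M m).2 i j := fun i j hi hj =>
    staircaseLoop_apply_stable hG M h1 (by omega) le_rfl hi hj
  have hsub : (staircaseLoop G M n).2.submatrix
      (Subtype.val : {i : Fin n // m + 1 ≤ i.val + 1 ∧ i.val + 1 ≤ lastNeighbor G m} → Fin n)
      (Subtype.val : {i : Fin n // m + 1 ≤ i.val + 1 ∧ i.val + 1 ≤ lastNeighbor G m} → Fin n)
      = (staircaseLoop G M m).2.submatrix Subtype.val Subtype.val := by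
    ext i j
    exact hrow _ _ i.2.2 j.2.2
  rw [hsub, Matrix.mul_assoc, Matrix.mul_assoc, Matrix.mul_apply, Matrix.mul_apply]
  refine Finset.sum_congr rfl fun i _ => ?_
  rw [Matrix.submatrix_apply, Matrix.submatrix_apply, id, hrow u i.1 (by omega) i.2.2,
    Matrix.mul_apply, Matrix.mul_apply]
  congr 1
  refine Finset.sum_congr rfl fun j _ => ?_
  congr 1
  -- The block $P[Y,Z]$ is specified data: $v\le J(m+1)\le J(j)$ for $j\in Y$.
  have hp : InPattern G j.1 v := by
    refine inPattern_of_le_lastNeighbor hG (Fin.le_def.mpr (by have := j.2.2; omega)) ?_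
    exact hv'.trans (lastNeighbor_mono hG (Nat.le_add_left 1 m) j.2.1 j.1.2)
  rw [Matrix.submatrix_apply, Matrix.submatrix_apply, id,
    staircaseLoop_apply_of_inPattern hG M hp h1 (by omega),
    staircaseLoop_apply_of_inPattern hG M hp (by omega) le_rfl]

end Staircase

/-! ### The central completion -/

section CentralCompletion

variable {n : ℕ} {G : SimpleGraph (Fin n)} {H : PartialMatrix G}

theorem centralCompletion_isCompletion (hG : IsBanded G) (H : PartialMatrix G) :
    IsCompletion H (centralCompletion H) := by
  rintro ⟨⟨i, j⟩, hp⟩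
  have hn : 1 ≤ n := by have := i.2; omega
  exact (staircaseLoop_apply_of_inPattern hG _ hp hn le_rfl).trans (dif_pos hp)

theorem centralCompletion_isHermitian (hG : IsBanded G)
    (hH : ∀ i j (h : InPattern G i j), H ⟨(j, i), h.symm⟩ = star (H ⟨(i, j), h⟩)) :
    (centralCompletion H).IsHermitian := by
  rcases Nat.eq_zero_or_pos n with rfl | hn
  · ext i; exact i.elim0
  refine staircaseLoop_isHermitian hG ?_ hn le_rfl
  refine Matrix.IsHermitian.ext fun i j => ?_
  by_cases h : InPattern G i j
  · rw [dif_pos h, dif_pos h.symm, hH i j h, star_star]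
  · rw [dif_neg h, dif_neg fun h' => h h'.symm, star_zero]

theorem submatrix_eq_cliqueSubmatrix {K : Matrix (Fin n) (Fin n) ℂ} (hK : IsCompletion H K)
    (s : Finset (Fin n)) (hs : G.IsClique (s : Set (Fin n))) :
    K.submatrix (Subtype.val : s → Fin n) Subtype.val = cliqueSubmatrix H s hs := by
  ext i j
  exact hK ⟨(i.1, j.1), (eq_or_ne i.1 j.1).imp id fun h => hs i.2 j.2 h⟩

theorem exists_adaptedBasis_centralCompletion (hG : IsBanded G)
    (hH : ∀ i j (h : InPattern G i j), H ⟨(j, i), h.symm⟩ = star (H ⟨(i, j), h⟩))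
    (hcl : ∀ (s : Finset (Fin n)) (hs : G.IsClique (s : Set (Fin n))),
      (cliqueSubmatrix H s hs).PosSemidef) :
    ∃ U, IsAdaptedBasis G (centralCompletion H) U := by
  classical
  have hKh := centralCompletion_isHermitian hG hH
  have hKc := centralCompletion_isCompletion hG H
  have hKcl : ∀ s : Finset (Fin n), G.IsClique (s : Set (Fin n)) →
      ((centralCompletion H).submatrix (Subtype.val : s → Fin n) Subtype.val).PosSemidef := by
    intro s hs
    rw [submatrix_eq_cliqueSubmatrix hKc s hs]
    exact hcl s hs
  refine exists_adaptedBasis hG hKh hKcl fun l v hlv hp => ?_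
  -- The least $b=m+1$ reaching $v$ is the pass that fills column $v$ above the band. As $l$ does
  -- not reach $v$, it lies above this step, and $z$ is the Schur residual of $v$ against
  -- $Y=\{m+1,\dots,J(m)\}$. Rows up to $m$ are handled by the fill-in formula, rows in $Y$ by the
  -- clique $\{m+1,\dots,J(m+1)\}$.
  have hex : ∃ b, v.val + 1 ≤ lastNeighbor G b :=
    ⟨v.val + 1, le_lastNeighbor_self G (Nat.le_add_left 1 _) v.2⟩
  obtain ⟨b, hb, hmin⟩ : ∃ b, v.val + 1 ≤ lastNeighbor G b ∧
      ∀ a, a < b → lastNeighbor G a < v.val + 1 :=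
    ⟨Nat.find hex, Nat.find_spec hex, fun a ha => not_le.mp (Nat.find_min hex ha)⟩
  have hbv : b ≤ v.val + 1 := by
    by_contra h
    have h1 := hmin _ (not_le.mp h)
    have h2 := le_lastNeighbor_self G (Nat.le_add_left 1 v.val) v.2
    omega
  have hlJ : lastNeighbor G (l.val + 1) < v.val + 1 := by
    by_contra h
    exact hp (inPattern_of_le_lastNeighbor hG hlv.le (not_lt.mp h))
  have hb0 : b ≠ 0 := by
    rintro rfl
    rw [lastNeighbor_zero] at hb
    omega
  have hvn := v.2
  have hbl : l.val + 1 < b := by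
    by_contra h
    have := lastNeighbor_mono hG (a := b) (b := l.val + 1) (by omega) (by omega) (by omega)
    omega
  obtain ⟨m, rfl⟩ : ∃ m, b = m + 1 := ⟨b - 1, by omega⟩
  have hJm := hmin m (by omega)
  have hm := le_lastNeighbor_self G (m := m) (by omega) (by omega)
  set p : Fin n → Prop := fun i => m + 1 ≤ i.val + 1 ∧ i.val + 1 ≤ lastNeighbor G m with hpdef
  refine ⟨schurResidual (centralCompletion H) p v, schurResidual_apply_self fun h => ?_,
    fun i hi => ?_, fun w hlw hw => ?_⟩
  · exact absurd h.2 (by omega)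
  · rcases schurResidual_supp hi with rfl | h
    · exact ⟨hlv, le_rfl⟩
    · obtain ⟨h1, h2⟩ := h
      exact ⟨Fin.lt_def.mpr (by omega), Fin.le_def.mpr (by omega)⟩
  · have hwJ : w.val + 1 ≤ lastNeighbor G m :=
      (le_lastNeighbor hw).trans (lastNeighbor_mono hG (by omega) (by omega) (by omega))
    rcases le_or_gt (w.val + 1) m with h | h
    · exact staircaseLoop_mulVec_schurResidual hG _ (by omega) (by omega) h hJm hb
    · set s : Finset (Fin n) := Finset.univ.filter fun i =>
        m + 1 ≤ i.val + 1 ∧ i.val + 1 ≤ lastNeighbor G (m + 1) with hsdef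
      have hmem : ∀ i, i ∈ s ↔ m + 1 ≤ i.val + 1 ∧ i.val + 1 ≤ lastNeighbor G (m + 1) :=
        fun i => by simp [hsdef]
      have hs : G.IsClique (s : Set (Fin n)) := by
        refine isClique_neighbors_ge hG (⟨m, by omega⟩ : Fin n) s fun i hi => ?_
        have hi := (hmem i).mp hi
        have hle : (⟨m, by omega⟩ : Fin n) ≤ i := Fin.le_def.mpr (by change m ≤ i.val; omega)
        exact ⟨hle, inPattern_of_le_lastNeighbor hG hle hi.2⟩
      refine mulVec_schurResidual_eq_zero hKh (hKcl s hs) (fun i hi => (hmem i).mpr ?_)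
        ((hmem v).mpr ⟨by omega, hb⟩) ⟨by omega, hwJ⟩
      exact ⟨hi.1, by have := hi.2; omega⟩

end CentralCompletion


/-! ### Simultaneous diagonalization of two positive semidefinite matrices -/

section Simultaneous

variable {ι : Type*} [Fintype ι] [DecidableEq ι]

theorem posSemidef_apply_eq_zero {A : Matrix ι ι ℂ} (hA : A.PosSemidef) {j : ι} (hj : A j j = 0)
    (i : ι) : A i j = 0 := by
  have h : star (Pi.single j 1 : ι → ℂ) ⬝ᵥ (A *ᵥ Pi.single j 1) = 0 := by
    rw [← Pi.single_star, star_one, single_one_dotProduct, Matrix.mulVec_single_one]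
    exact hj
  have := congrFun ((hA.dotProduct_mulVec_zero_iff _).mp h) i
  rwa [Matrix.mulVec_single_one] at this

theorem exists_unitary_diagonalization {A : Matrix ι ι ℂ} (hA : A.IsHermitian) :
    ∃ (V : Matrix ι ι ℂ) (d : ι → ℝ), Vᴴ * V = 1 ∧ Vᴴ * A * V = Matrix.diagonal fun i => (d i : ℂ) := by
  have hu : (hA.eigenvectorUnitary : Matrix ι ι ℂ)ᴴ * (hA.eigenvectorUnitary : Matrix ι ι ℂ) = 1 :=
    Unitary.coe_star_mul_self hA.eigenvectorUnitary
  have hs := hA.spectral_theorem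
  rw [Unitary.conjStarAlgAut_apply] at hs
  change A = (hA.eigenvectorUnitary : Matrix ι ι ℂ) * _
    * (hA.eigenvectorUnitary : Matrix ι ι ℂ)ᴴ at hs
  refine ⟨hA.eigenvectorUnitary, hA.eigenvalues, hu, ?_⟩
  generalize (hA.eigenvectorUnitary : Matrix ι ι ℂ) = V at hu hs
  generalize hA.eigenvalues = d at hs
  calc Vᴴ * A * V = (Vᴴ * V) * Matrix.diagonal (RCLike.ofReal ∘ d) * (Vᴴ * V) := by
        rw [hs]; simp only [Matrix.mul_assoc]
    _ = _ := by rw [hu, Matrix.one_mul, Matrix.mul_one]; rfl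

theorem PosSemidef.exists_congruence_projection {M : Matrix ι ι ℂ} (hM : M.PosSemidef) :
    ∃ (Q : Matrix ι ι ℂ) (p : ι → ℂ), IsUnit Q ∧ (∀ i, p i = 0 ∨ p i = 1) ∧
      Qᴴ * M * Q = Matrix.diagonal p := by
  obtain ⟨V, d, hV, hd⟩ := exists_unitary_diagonalization hM.1
  have hd0 : ∀ i, 0 ≤ d i := fun i => by
    have := (hM.conjTranspose_mul_mul_same V).diag_nonneg (i := i)
    rwa [hd, Matrix.diagonal_apply_eq, Complex.zero_le_real] at this
  set s : ι → ℝ := fun i => if d i = 0 then 1 else (Real.sqrt (d i))⁻¹ with hs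
  have hs0 : ∀ i, s i ≠ 0 := fun i => by
    by_cases h : d i = 0
    · simp [hs, h]
    · simp [hs, h, Real.sqrt_eq_zero (hd0 i)]
  refine ⟨V * Matrix.diagonal fun i => (s i : ℂ), fun i => if d i = 0 then 0 else 1, ?_,
    fun i => by by_cases h : d i = 0 <;> simp [h], ?_⟩
  · refine IsUnit.mul ?_ ?_
    · exact IsUnit.of_mul_eq_one_right _ hV
    · rw [Matrix.isUnit_iff_isUnit_det, Matrix.det_diagonal, isUnit_iff_ne_zero]
      exact Finset.prod_ne_zero_iff.mpr fun i _ => Complex.ofReal_ne_zero.mpr (hs0 i)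
  · have : (V * Matrix.diagonal fun i => (s i : ℂ))ᴴ * M * (V * Matrix.diagonal fun i => (s i : ℂ))
        = (Matrix.diagonal fun i => (s i : ℂ))ᴴ * (Vᴴ * M * V)
          * Matrix.diagonal fun i => (s i : ℂ) := by
      rw [Matrix.conjTranspose_mul]; simp only [Matrix.mul_assoc]
    rw [this, hd, Matrix.diagonal_conjTranspose, Matrix.diagonal_mul_diagonal,
      Matrix.diagonal_mul_diagonal]
    congr 1
    funext i
    rw [Pi.star_apply, Complex.star_def, Complex.conj_ofReal, ← Complex.ofReal_mul,
      ← Complex.ofReal_mul]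
    by_cases h : d i = 0
    · simp [h]
    · have h1 : Real.sqrt (d i) ≠ 0 := by simpa [Real.sqrt_eq_zero (hd0 i)] using h
      have h2 : s i * d i * s i = 1 := by
        simp only [hs, if_neg h]
        nth_rewrite 2 [← Real.mul_self_sqrt (hd0 i)]
        field_simp
      rw [h2, if_neg h, Complex.ofReal_one]

/-- A congruence turns $A+B$ into a coordinate projection $P$. A unitary that diagonalizes both the
transformed $A$ and $P$ then diagonalizes the transformed $B$ as their difference. -/
theorem exists_simultaneous_congruence {A B : Matrix ι ι ℂ} (hA : A.PosSemidef)
    (hB : B.PosSemidef) : ∃ (T : Matrix ι ι ℂ) (a b : ι → ℝ), IsUnit T ∧ (∀ i, 0 ≤ a i) ∧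
      (∀ i, 0 ≤ b i) ∧ A = T * Matrix.diagonal (fun i => (a i : ℂ)) * Tᴴ ∧
      B = T * Matrix.diagonal (fun i => (b i : ℂ)) * Tᴴ := by
  obtain ⟨Q, p, hQ, hp, hQM⟩ := PosSemidef.exists_congruence_projection (hA.add hB)
  have hA1 := hA.conjTranspose_mul_mul_same Q
  have hB1 := hB.conjTranspose_mul_mul_same Q
  have hAB1 : Qᴴ * A * Q + Qᴴ * B * Q = Matrix.diagonal p := by
    rw [← hQM, Matrix.mul_add, Matrix.add_mul]
  set A1 := Qᴴ * A * Q with hA1def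
  set P : Matrix ι ι ℂ := Matrix.diagonal p with hPdef
  have hPP : P * P = P := by
    rw [hPdef, Matrix.diagonal_mul_diagonal]
    congr 1
    funext i
    rcases hp i with h | h <;> simp [h]
  have hAP : A1 * P = A1 := by
    ext i j
    rw [hPdef, Matrix.mul_diagonal]
    rcases hp j with h | h
    · have hz : A1 j j = 0 := by
        have hsum := congrFun (congrFun hAB1 j) j
        rw [Matrix.add_apply, hPdef, Matrix.diagonal_apply_eq, h] at hsum
        exact ((add_eq_zero_iff_of_nonneg hA1.diag_nonneg hB1.diag_nonneg).mp hsum).1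
      rw [h, mul_zero, posSemidef_apply_eq_zero hA1 hz]
    · rw [h, mul_one]
  have hPH : Pᴴ = P := by
    rw [hPdef, Matrix.diagonal_conjTranspose]
    congr 1
    funext i
    rcases hp i with h | h <;> simp [h]
  -- This matrix acts as $A_1\succeq0$ on $\operatorname{ran}P$ and as $-1$ on $\ker P$. Its
  -- spectrum separates the two subspaces, so one unitary diagonalizes $A_1$ and $P$ together.
  have hN : (A1 - (1 - P)).IsHermitian :=
    hA1.1.sub (Matrix.isHermitian_one.sub hPH)
  obtain ⟨V, d, hV, hd⟩ := exists_unitary_diagonalization hN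
  have hV' : V * Vᴴ = 1 := mul_eq_one_comm.mp hV
  have hA2 := hA1.conjTranspose_mul_mul_same V
  have hB2 := hB1.conjTranspose_mul_mul_same V
  set A2 := Vᴴ * A1 * V with hA2def
  set P2 := Vᴴ * P * V with hP2def
  have hP2psd : P2.PosSemidef := by
    have : P2 = (P * V)ᴴ * (P * V) := by
      rw [Matrix.conjTranspose_mul, hPH, Matrix.mul_assoc, ← Matrix.mul_assoc P, hPP, hP2def,
        Matrix.mul_assoc]
    rw [this]
    exact Matrix.posSemidef_conjTranspose_mul_self _
  have hAB2 : A2 + Vᴴ * (Qᴴ * B * Q) * V = P2 := by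
    rw [hA2def, hP2def, ← hAB1, Matrix.mul_add, Matrix.add_mul]
  have hmul : ∀ X Y : Matrix ι ι ℂ, Vᴴ * X * V * (Vᴴ * Y * V) = Vᴴ * (X * Y) * V := by
    intro X Y
    calc Vᴴ * X * V * (Vᴴ * Y * V) = Vᴴ * X * (V * Vᴴ) * Y * V := by simp only [Matrix.mul_assoc]
      _ = _ := by rw [hV', Matrix.mul_one]; simp only [Matrix.mul_assoc]
  have hdP : Matrix.diagonal (fun i => (d i : ℂ)) * P2 = A2 := by
    rw [← hd, hP2def, hmul, Matrix.sub_mul, Matrix.sub_mul, Matrix.one_mul, hPP, sub_self, sub_zero,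
      hAP]
  have hd1 : Matrix.diagonal (fun i => (d i : ℂ)) * (1 - P2) = -(1 - P2) := by
    rw [Matrix.mul_sub, Matrix.mul_one, hdP, ← hd, Matrix.mul_sub, Matrix.sub_mul, Matrix.mul_sub,
      Matrix.sub_mul, Matrix.mul_one, hV]
    abel
  have hP2diag : ∀ i j, i ≠ j → P2 i j = 0 := by
    intro i j hij
    by_cases hdi : (d i : ℂ) = -1
    · have hii : A2 i i = -P2 i i := by
        rw [← hdP, Matrix.diagonal_mul, hdi, neg_one_mul]
      have h1 := hA2.diag_nonneg (i := i)
      have h2 := hP2psd.diag_nonneg (i := i)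
      rw [hii] at h1
      have h0 : P2 i i = 0 := le_antisymm (neg_nonneg.mp h1) h2
      rw [← hP2psd.1.apply, posSemidef_apply_eq_zero hP2psd h0, star_zero]
    · have := congrFun (congrFun hd1 i) j
      rw [Matrix.diagonal_mul, Matrix.neg_apply, Matrix.sub_apply, Matrix.one_apply_ne hij] at this
      have h0 : ((d i : ℂ) + 1) * P2 i j = 0 := by linear_combination -this
      exact (mul_eq_zero.mp h0).resolve_left fun h => hdi (eq_neg_of_add_eq_zero_left h)
  have hA2diag : ∀ i j, i ≠ j → A2 i j = 0 := fun i j hij => by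
    rw [← hdP, Matrix.diagonal_mul, hP2diag i j hij, mul_zero]
  have hB2diag : ∀ i j, i ≠ j → (Vᴴ * (Qᴴ * B * Q) * V) i j = 0 := fun i j hij => by
    have := congrFun (congrFun hAB2 i) j
    rwa [Matrix.add_apply, hA2diag i j hij, hP2diag i j hij, zero_add] at this
  have hreal : ∀ {X : Matrix ι ι ℂ}, X.PosSemidef → (∀ i j, i ≠ j → X i j = 0) →
      X = Matrix.diagonal fun i => ((X i i).re : ℂ) := by
    intro X hX hXd
    ext i j
    by_cases hij : i = j
    · subst hij
      rw [Matrix.diagonal_apply_eq]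
      exact Complex.ext rfl (Complex.nonneg_iff.mp hX.diag_nonneg).2.symm
    · rw [Matrix.diagonal_apply_ne _ hij, hXd i j hij]
  have hQV : IsUnit (Q * V) := hQ.mul (IsUnit.of_mul_eq_one_right _ hV)
  have hdet := (Matrix.isUnit_iff_isUnit_det _).mp hQV
  have hS1 := Matrix.mul_nonsing_inv _ hdet
  have hS2 : ((Q * V)⁻¹)ᴴ * (Q * V)ᴴ = 1 := by
    rw [← Matrix.conjTranspose_mul, hS1, Matrix.conjTranspose_one]
  have hback : ∀ X : Matrix ι ι ℂ,
      X = ((Q * V)⁻¹)ᴴ * (Vᴴ * (Qᴴ * X * Q) * V) * (((Q * V)⁻¹)ᴴ)ᴴ := by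
    intro X
    rw [Matrix.conjTranspose_conjTranspose]
    calc X = (((Q * V)⁻¹)ᴴ * (Q * V)ᴴ) * X * ((Q * V) * (Q * V)⁻¹) := by
          rw [hS1, hS2, Matrix.one_mul, Matrix.mul_one]
      _ = _ := by
          rw [Matrix.conjTranspose_mul Q V]
          simp only [Matrix.mul_assoc]
  refine ⟨((Q * V)⁻¹)ᴴ, fun i => (A2 i i).re, fun i => ((Vᴴ * (Qᴴ * B * Q) * V) i i).re,
    IsUnit.of_mul_eq_one _ hS2, fun i => (Complex.nonneg_iff.mp hA2.diag_nonneg).1,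
    fun i => (Complex.nonneg_iff.mp hB2.diag_nonneg).1, ?_, ?_⟩
  · rw [← hreal hA2 hA2diag]
    exact hback A
  · rw [← hreal hB2 hB2diag]
    exact hback B

end Simultaneous

/-! ### The phase-bounded cone -/

section Cone

variable {ι : Type*}

/-- The Hermitian matrix `(e^{-iθ} X - e^{iθ} X*) / (2i)`, the imaginary part of `e^{-iθ} X`. -/
noncomputable def imRot (θ : ℝ) (X : Matrix ι ι ℂ) : Matrix ι ι ℂ :=
  (1 / (2 * Complex.I)) •
    (Complex.exp (-(Complex.I * (θ : ℂ))) • X - Complex.exp (Complex.I * (θ : ℂ)) • Xᴴ)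

theorem star_exp_I_mul (θ : ℝ) :
    star (Complex.exp (Complex.I * (θ : ℂ))) = Complex.exp (-(Complex.I * (θ : ℂ))) := by
  rw [Complex.star_def, ← Complex.exp_conj, map_mul, Complex.conj_I, Complex.conj_ofReal, neg_mul]

theorem im_eq_sub_star (z : ℂ) : ((z.im : ℝ) : ℂ) = 1 / (2 * Complex.I) * (z - star z) := by
  rw [Complex.star_def, Complex.sub_conj]
  field_simp
  push_cast
  ring

theorem imRot_diagonal [DecidableEq ι] (θ : ℝ) (z : ι → ℂ) : imRot θ (Matrix.diagonal z)
    = Matrix.diagonal fun i => (((Complex.exp (-(Complex.I * (θ : ℂ))) * z i).im : ℝ) : ℂ) := by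
  ext i j
  rw [imRot, Matrix.diagonal_conjTranspose, Matrix.smul_apply, Matrix.sub_apply, Matrix.smul_apply,
    Matrix.smul_apply]
  by_cases hij : i = j
  · subst hij
    simp only [Matrix.diagonal_apply_eq, im_eq_sub_star, star_mul', ← star_exp_I_mul, star_star,
      Pi.star_apply, smul_eq_mul]
  · simp only [Matrix.diagonal_apply_ne _ hij, smul_zero, sub_zero]

variable [Fintype ι]

theorem imRot_congruence (θ : ℝ) (T X : Matrix ι ι ℂ) :
    imRot θ (T * X * Tᴴ) = T * imRot θ X * Tᴴ := by
  simp only [imRot, Matrix.conjTranspose_mul, Matrix.conjTranspose_conjTranspose, Matrix.mul_smul,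
    Matrix.smul_mul, Matrix.mul_sub, Matrix.sub_mul, Matrix.mul_assoc]

theorem star_dotProduct_imRot_mulVec (θ : ℝ) (X : Matrix ι ι ℂ) (x : ι → ℂ) :
    star x ⬝ᵥ (imRot θ X *ᵥ x)
      = (((Complex.exp (-(Complex.I * (θ : ℂ))) * (star x ⬝ᵥ (X *ᵥ x))).im : ℝ) : ℂ) := by
  have h : star x ⬝ᵥ (Xᴴ *ᵥ x) = star (star x ⬝ᵥ (X *ᵥ x)) := by
    rw [Matrix.star_dotProduct, Matrix.star_mulVec, ← Matrix.dotProduct_mulVec,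
      Matrix.conjTranspose_conjTranspose]
  rw [im_eq_sub_star, star_mul', ← h, ← star_exp_I_mul, star_star, imRot, Matrix.smul_mulVec,
    Matrix.sub_mulVec, Matrix.smul_mulVec, Matrix.smul_mulVec, dotProduct_smul, dotProduct_sub,
    dotProduct_smul, dotProduct_smul, star_exp_I_mul]
  rfl

theorem isSemisectorial_of_imRot_posSemidef {α : ℝ} {X : Matrix ι ι ℂ}
    (hX : (imRot α X).PosSemidef) : IsSemisectorial X := by
  intro h0
  rw [mem_interior_iff_mem_nhds, Metric.mem_nhds_iff] at h0
  obtain ⟨ε, hε, hball⟩ := h0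
  -- A small point on the wrong side of the half-plane $\mathrm{Im}(e^{-i\alpha}z)\ge0$ that
  -- contains the numerical range.
  set z : ℂ := -((ε / 2 : ℝ) : ℂ) * Complex.I * Complex.exp (Complex.I * (α : ℂ)) with hz
  have hnorm : ‖z‖ = ε / 2 := by
    rw [hz, norm_mul, norm_mul, norm_neg, Complex.norm_real, Complex.norm_I, mul_comm Complex.I,
      Complex.norm_exp_ofReal_mul_I, mul_one, mul_one, Real.norm_of_nonneg (by linarith)]
  obtain ⟨x, -, hx⟩ := hball (show z ∈ Metric.ball 0 ε by
    rw [mem_ball_zero_iff, hnorm]; linarith)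
  have h1 := hX.dotProduct_mulVec_nonneg x
  rw [star_dotProduct_imRot_mulVec, ← hx, Complex.zero_le_real, hz] at h1
  have h2 : Complex.exp (-(Complex.I * (α : ℂ)))
      * (-((ε / 2 : ℝ) : ℂ) * Complex.I * Complex.exp (Complex.I * (α : ℂ)))
      = -((ε / 2 : ℝ) : ℂ) * Complex.I := by
    rw [mul_comm, mul_assoc, ← Complex.exp_add, add_neg_cancel, Complex.exp_zero, mul_one]
  rw [h2] at h1
  simp at h1
  linarith

variable [DecidableEq ι]

theorem exp_neg_I_mul_exp_im (θ t : ℝ) :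
    (Complex.exp (-(Complex.I * (θ : ℂ))) * Complex.exp (Complex.I * (t : ℂ))).im
      = Real.sin (t - θ) := by
  rw [← Complex.exp_add]
  have : -(Complex.I * (θ : ℂ)) + Complex.I * (t : ℂ) = ((t - θ : ℝ) : ℂ) * Complex.I := by
    push_cast; ring
  rw [this, Complex.exp_ofReal_mul_I_im]

theorem canonicalForm_zero_right (k l : ℕ) (a : Fin l → ℝ) (γ : ℝ) :
    canonicalForm k l 0 a γ = Matrix.diagonal (Sum.elim 0
      (Sum.elim (fun j => Complex.exp (Complex.I * (a j : ℂ))) fun _ => 0)) := by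
  ext i j
  rcases i with i | i | ⟨_, i⟩ <;> rcases j with j | j | ⟨_, j⟩
  · simp [canonicalForm, Matrix.diagonal_apply]
  · simp [canonicalForm]
  · exact j.elim0
  · simp [canonicalForm]
  · simp [canonicalForm, Matrix.diagonal_apply]
  · exact j.elim0
  · exact i.elim0
  · exact i.elim0
  · exact i.elim0

/-- A nonnegative combination of `e^{iα}` and `e^{iβ}` is zero or has an argument in `[α, β]`. -/
theorem exists_polar_of_cone {α β : ℝ} (h₀ : 0 < β - α) (hπ : β - α < Real.pi) {a b : ℝ}
    (ha : 0 ≤ a) (hb : 0 ≤ b) : ∃ s θ : ℝ, s ≠ 0 ∧ α ≤ θ ∧ θ ≤ β ∧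
      (Complex.exp (Complex.I * (β : ℂ)) * a + Complex.exp (Complex.I * (α : ℂ)) * b = 0 ∨
      Complex.exp (Complex.I * (β : ℂ)) * a + Complex.exp (Complex.I * (α : ℂ)) * b
        = s * Complex.exp (Complex.I * (θ : ℂ)) * s) := by
  by_cases hz : Complex.exp (Complex.I * (β : ℂ)) * a + Complex.exp (Complex.I * (α : ℂ)) * b = 0
  · exact ⟨1, α, one_ne_zero, le_rfl, by linarith, Or.inl hz⟩
  have hsin := Real.sin_pos_of_pos_of_lt_pi h₀ hπ
  -- Rotating by $e^{-i\alpha}$ moves the sector into the closed upper half-plane, where the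
  -- principal argument needs no unwrapping.
  set w : ℂ := Complex.exp (((β - α : ℝ) : ℂ) * Complex.I) * a + b with hw
  have hzw : Complex.exp (Complex.I * (β : ℂ)) * a + Complex.exp (Complex.I * (α : ℂ)) * b
      = Complex.exp (Complex.I * (α : ℂ)) * w := by
    rw [hw, mul_add, ← mul_assoc, ← Complex.exp_add]
    congr 3
    push_cast
    ring
  have hw0 : w ≠ 0 := fun h => hz (by rw [hzw, h, mul_zero])
  have him : w.im = Real.sin (β - α) * a := by
    rw [hw, Complex.add_im, Complex.ofReal_im, add_zero, Complex.im_mul_ofReal,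
      Complex.exp_ofReal_mul_I_im]
  have hre : w.re = Real.cos (β - α) * a + b := by
    rw [hw, Complex.add_re, Complex.ofReal_re, Complex.re_mul_ofReal, Complex.exp_ofReal_mul_I_re]
  have hpos : 0 < ‖w‖ := norm_pos_iff.mpr hw0
  have harg0 : 0 ≤ Complex.arg w := Complex.arg_nonneg_iff.mpr (him ▸ mul_nonneg hsin.le ha)
  have hargle : Complex.arg w ≤ β - α := by
    by_contra hlt
    -- Contradiction from $|w|\sin(\arg w-(\beta-\alpha))=-b\sin(\beta-\alpha)\le0$.
    have hs : 0 < Real.sin (Complex.arg w - (β - α)) :=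
      Real.sin_pos_of_pos_of_lt_pi (by linarith) (by linarith [Complex.arg_le_pi w])
    rw [Real.sin_sub, Complex.sin_arg, Complex.cos_arg hw0, him, hre] at hs
    have := mul_pos hpos hs
    have e : ‖w‖ * (Real.sin (β - α) * a / ‖w‖ * Real.cos (β - α)
        - (Real.cos (β - α) * a + b) / ‖w‖ * Real.sin (β - α)) = -(b * Real.sin (β - α)) := by
      field_simp
      ring
    rw [e] at this
    linarith [mul_nonneg hb hsin.le]
  refine ⟨Real.sqrt ‖w‖, α + Complex.arg w, (Real.sqrt_pos.mpr hpos).ne', by linarith,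
    by linarith, Or.inr ?_⟩
  have hsq : ((Real.sqrt ‖w‖ : ℝ) : ℂ) * ((Real.sqrt ‖w‖ : ℝ) : ℂ) = (‖w‖ : ℂ) := by
    rw [← Complex.ofReal_mul, Real.mul_self_sqrt hpos.le]
  rw [hzw]
  nth_rewrite 1 [← Complex.norm_mul_exp_arg_mul_I w]
  rw [← hsq]
  have : Complex.I * ((α + Complex.arg w : ℝ) : ℂ)
      = Complex.I * (α : ℂ) + (Complex.arg w : ℂ) * Complex.I := by push_cast; ring
  rw [this, Complex.exp_add]
  ring

theorem sin_sub_eq_exp (α β : ℝ) : (Real.sin (β - α) : ℂ) = 1 / (2 * Complex.I) *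
    (Complex.exp (Complex.I * (β : ℂ)) * Complex.exp (-(Complex.I * (α : ℂ)))
      - Complex.exp (Complex.I * (α : ℂ)) * Complex.exp (-(Complex.I * (β : ℂ)))) := by
  rw [← exp_neg_I_mul_exp_im, im_eq_sub_star, star_mul', star_exp_I_mul, ← star_exp_I_mul α,
    star_star]
  ring

theorem mem_phaseBoundedCone_of_diagonal {α β : ℝ} (hπ : β - α < Real.pi)
    {T X : Matrix ι ι ℂ} (hsemi : IsSemisectorial X) (hT : IsUnit T) {z : ι → ℂ} {θ : ι → ℝ}
    (hθ : ∀ i, α ≤ θ i ∧ θ i ≤ β) (hz : ∀ i, z i = 0 ∨ z i = Complex.exp (Complex.I * (θ i : ℂ)))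
    (hX : X = T * Matrix.diagonal z * Tᴴ) : X ∈ phaseBoundedCone α β := by
  classical
  let e₀ : Fin (Fintype.card {i // z i = 0}) ≃ {i // z i = 0} := (Fintype.equivFin _).symm
  let e₁ : Fin (Fintype.card {i // ¬z i = 0}) ≃ {i // ¬z i = 0} := (Fintype.equivFin _).symm
  let e : (Fin (Fintype.card {i // z i = 0}) ⊕ Fin (Fintype.card {i // ¬z i = 0}) ⊕
      (Fin 2 × Fin 0)) ≃ ι :=
    (Equiv.sumCongr e₀ ((Equiv.sumEmpty _ _).trans e₁)).trans (Equiv.sumCompl fun i => z i = 0)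
  have hmem : ∀ t ∈ Multiset.map (fun j => θ (e₁ j).1) Finset.univ.val
      + Multiset.replicate 0 (α - Real.pi / 2) + Multiset.replicate 0 (α + Real.pi / 2),
      α ≤ t ∧ t ≤ β := by
    intro t ht
    simp only [Multiset.replicate_zero, add_zero, Multiset.mem_map] at ht
    obtain ⟨j, -, rfl⟩ := ht
    exact hθ _
  refine ⟨_, ⟨hsemi, _, _, 0, fun j => θ (e₁ j).1, α, e, T, hT, ?_, rfl, α, fun t ht => ?_⟩, hmem⟩
  · rw [hX, canonicalForm_zero_right, Matrix.reindex_apply, Matrix.submatrix_diagonal_equiv]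
    congr 3
    rw [Equiv.eq_comp_symm]
    funext i
    rcases i with i | i | ⟨-, i⟩
    · exact (e₀ i).2
    · exact (hz _).resolve_left (e₁ i).2
    · exact i.elim0
  · exact ⟨(hmem t ht).1, by linarith [(hmem t ht).2]⟩

/-- Here `y` plays the role of the conjugate transposed entry. Its coefficients cancel, so the
identity holds for independent `x` and `y` and applies entry by entry. -/
theorem phaseCombine_scalar {α β : ℝ} (hs : Real.sin (β - α) ≠ 0) (x y : ℂ) :
    1 / (Real.sin (β - α) : ℂ) *
      (Complex.exp (Complex.I * (β : ℂ)) * (1 / (2 * Complex.I) *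
          (Complex.exp (-(Complex.I * (α : ℂ))) * x - Complex.exp (Complex.I * (α : ℂ)) * y))
        + Complex.exp (Complex.I * (α : ℂ)) * -(1 / (2 * Complex.I) *
          (Complex.exp (-(Complex.I * (β : ℂ))) * x - Complex.exp (Complex.I * (β : ℂ)) * y)))
      = x := by
  have hs' : (Real.sin (β - α) : ℂ) ≠ 0 := Complex.ofReal_ne_zero.mpr hs
  rw [one_div, inv_mul_eq_iff_eq_mul₀ hs', sin_sub_eq_exp]
  ring

/-- Both conditions are invariant under congruence. For a unimodular diagonal entry $e^{it}$ with
$t\in[\alpha,\beta]$ they read $\sin(t-\alpha)\ge0$ and $\sin(\beta-t)\ge0$. -/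
theorem mem_phaseBoundedCone_iff {α β : ℝ} (h₀ : 0 < β - α) (hπ : β - α < Real.pi)
    {X : Matrix ι ι ℂ} :
    X ∈ phaseBoundedCone α β ↔ (imRot α X).PosSemidef ∧ (-imRot β X).PosSemidef := by
  have hsin := Real.sin_pos_of_pos_of_lt_pi h₀ hπ
  constructor
  · rintro ⟨φ, ⟨-, k, l, m, a, γ, e, T, -, hX, hφ, -⟩, hmem⟩
    -- A $2\times2$ block would contribute phases $\gamma\pm\pi/2$, which are $\pi$ apart.
    obtain rfl : m = 0 := by
      by_contra hm
      have h1 := (hmem (γ - Real.pi / 2) (by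
        rw [hφ]; simp [Multiset.mem_replicate, hm])).1
      have h2 := (hmem (γ + Real.pi / 2) (by
        rw [hφ]; simp [Multiset.mem_replicate, hm])).2
      linarith
    have ha : ∀ j, α ≤ a j ∧ a j ≤ β := fun j => hmem (a j) (by rw [hφ]; simp)
    rw [canonicalForm_zero_right, Matrix.reindex_apply, Matrix.submatrix_diagonal_equiv] at hX
    set d := (Sum.elim (0 : Fin k → ℂ) (Sum.elim (fun j => Complex.exp (Complex.I * (a j : ℂ)))
      fun _ : Fin 2 × Fin 0 => 0)) ∘ e.symm with hd
    have hdi : ∀ i, d i = 0 ∨ ∃ j, d i = Complex.exp (Complex.I * (a j : ℂ)) := by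
      intro i
      rw [hd, Function.comp_apply]
      rcases e.symm i with i | i | ⟨-, i⟩
      · exact Or.inl rfl
      · exact Or.inr ⟨i, rfl⟩
      · exact i.elim0
    rw [hX, imRot_congruence, imRot_congruence, imRot_diagonal, imRot_diagonal]
    constructor
    · refine Matrix.PosSemidef.mul_mul_conjTranspose_same (Matrix.PosSemidef.diagonal fun i => ?_) T
      rw [Pi.zero_apply, Complex.zero_le_real]
      rcases hdi i with h | ⟨j, h⟩
      · rw [h, mul_zero, Complex.zero_im]
      · rw [h, exp_neg_I_mul_exp_im]
        exact Real.sin_nonneg_of_nonneg_of_le_pi (by linarith [(ha j).1]) (by linarith [(ha j).2])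
    · rw [← Matrix.neg_mul, ← Matrix.mul_neg, Matrix.diagonal_neg]
      refine Matrix.PosSemidef.mul_mul_conjTranspose_same (Matrix.PosSemidef.diagonal fun i => ?_) T
      rw [Pi.zero_apply, ← Complex.ofReal_neg, Complex.zero_le_real]
      rcases hdi i with h | ⟨j, h⟩
      · rw [h, mul_zero, Complex.zero_im, neg_zero]
      · rw [h, exp_neg_I_mul_exp_im, ← Real.sin_neg, neg_sub]
        exact Real.sin_nonneg_of_nonneg_of_le_pi (by linarith [(ha j).2]) (by linarith [(ha j).1])
  · rintro ⟨hA, hB⟩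
    obtain ⟨T, a, b, hT, ha, hb, hTA, hTB⟩ := exists_simultaneous_congruence hA hB
    have hsc : ∀ i, 0 ≤ a i / Real.sin (β - α) ∧ 0 ≤ b i / Real.sin (β - α) := fun i =>
      ⟨div_nonneg (ha i) hsin.le, div_nonneg (hb i) hsin.le⟩
    choose s θ hs hθ1 hθ2 hz using fun i => exists_polar_of_cone h₀ hπ (hsc i).1 (hsc i).2
    set z : ι → ℂ := fun i =>
      Complex.exp (Complex.I * (β : ℂ)) * ((a i / Real.sin (β - α) : ℝ) : ℂ)
      + Complex.exp (Complex.I * (α : ℂ)) * ((b i / Real.sin (β - α) : ℝ) : ℂ) with hzdef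
    have hX : X = T * Matrix.diagonal z * Tᴴ := by
      have h1 : X = (1 / (Real.sin (β - α) : ℂ)) • (Complex.exp (Complex.I * (β : ℂ)) • imRot α X
          + Complex.exp (Complex.I * (α : ℂ)) • (-imRot β X)) := by
        ext i j
        exact (phaseCombine_scalar hsin.ne' (X i j) (Xᴴ i j)).symm
      have h2 : Matrix.diagonal z = (1 / (Real.sin (β - α) : ℂ)) •
          (Complex.exp (Complex.I * (β : ℂ)) • Matrix.diagonal (fun i => (a i : ℂ))
          + Complex.exp (Complex.I * (α : ℂ)) • Matrix.diagonal fun i => (b i : ℂ)) := by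
        ext i j
        by_cases hij : i = j
        · subst hij
          simp only [Matrix.diagonal_apply_eq, Matrix.smul_apply, Matrix.add_apply, smul_eq_mul,
            hzdef]
          push_cast
          ring
        · simp [Matrix.diagonal_apply_ne _ hij]
      rw [h1, hTA, hTB, h2]
      simp only [Matrix.mul_smul, Matrix.smul_mul, Matrix.mul_add, Matrix.add_mul]
    -- The moduli are absorbed into the congruence as $s\cdot\bar s$, leaving unimodular or zero
    -- entries.
    have hD : Matrix.diagonal z = Matrix.diagonal (fun i => (s i : ℂ))
        * Matrix.diagonal (fun i => if z i = 0 then 0 else Complex.exp (Complex.I * (θ i : ℂ)))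
        * (Matrix.diagonal fun i => (s i : ℂ))ᴴ := by
      rw [Matrix.diagonal_conjTranspose, Matrix.diagonal_mul_diagonal,
        Matrix.diagonal_mul_diagonal]
      congr 1
      funext i
      rw [Pi.star_apply, Complex.star_def, Complex.conj_ofReal]
      split_ifs with h
      · rw [h, mul_zero, zero_mul]
      · exact (hz i).resolve_left h
    refine mem_phaseBoundedCone_of_diagonal (T := T * Matrix.diagonal fun i => (s i : ℂ)) hπ
      (isSemisectorial_of_imRot_posSemidef hA) (hT.mul ?_) (fun i => ⟨hθ1 i, hθ2 i⟩)
      (z := fun i => if z i = 0 then 0 else Complex.exp (Complex.I * (θ i : ℂ))) (fun i => ?_) ?_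
    · rw [Matrix.isUnit_iff_isUnit_det, Matrix.det_diagonal, isUnit_iff_ne_zero]
      exact Finset.prod_ne_zero_iff.mpr fun i _ => Complex.ofReal_ne_zero.mpr (hs i)
    · by_cases h : z i = 0 <;> simp [h]
    · rw [hX, hD, Matrix.conjTranspose_mul]
      simp only [Matrix.mul_assoc]

end Cone

/-! ### Completions in the cone and pairs of positive semidefinite completions -/

section PhaseCombine

variable {n : ℕ} {G : SimpleGraph (Fin n)} {α β : ℝ}

theorem hermRot_apply (θ : ℝ) (C : PartialMatrix G)
    (p : {p : Fin n × Fin n // InPattern G p.1 p.2}) :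
    hermRot θ C p = 1 / (2 * Complex.I) * (Complex.exp (-(Complex.I * (θ : ℂ))) * C p
      - Complex.exp (Complex.I * (θ : ℂ)) * star (C ⟨(p.1.2, p.1.1), p.2.symm⟩)) := by
  have h1 : Complex.exp (Complex.I * (θ : ℂ)) = Real.cos θ + Real.sin θ * Complex.I := by
    rw [mul_comm, Complex.exp_mul_I, Complex.ofReal_cos, Complex.ofReal_sin]
  have h2 : Complex.exp (-(Complex.I * (θ : ℂ))) = Real.cos θ - Real.sin θ * Complex.I := by
    rw [← star_exp_I_mul, h1]
    simp [Complex.conj_ofReal, -Complex.ofReal_cos, -Complex.ofReal_sin, sub_eq_add_neg]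
  rw [h1, h2, hermRot, hermPart, skewPart, partialConjTranspose]
  generalize star (C ⟨(p.1.2, p.1.1), p.2.symm⟩) = y
  generalize C p = x
  field_simp
  ring

theorem skewRot_eq_neg_hermRot (θ : ℝ) (C : PartialMatrix G) : skewRot θ C = -hermRot θ C := by
  funext p
  rw [Pi.neg_apply, skewRot, hermRot]
  ring

theorem hermRot_symm (θ : ℝ) (C : PartialMatrix G) (i j : Fin n) (h : InPattern G i j) :
    hermRot θ C ⟨(j, i), h.symm⟩ = star (hermRot θ C ⟨(i, j), h⟩) := by
  rw [hermRot_apply, hermRot_apply, star_mul', star_sub, star_mul', star_mul', star_star,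
    ← star_exp_I_mul, star_star]
  have : star (1 / (2 * Complex.I)) = -(1 / (2 * Complex.I)) := by
    simp [Complex.conj_I]
  rw [this]
  ring

theorem skewRot_symm (θ : ℝ) (C : PartialMatrix G) (i j : Fin n) (h : InPattern G i j) :
    skewRot θ C ⟨(j, i), h.symm⟩ = star (skewRot θ C ⟨(i, j), h⟩) := by
  rw [skewRot_eq_neg_hermRot, Pi.neg_apply, Pi.neg_apply, star_neg, hermRot_symm]

theorem cliqueSubmatrix_hermRot (θ : ℝ) (C : PartialMatrix G) (s : Finset (Fin n))
    (hs : G.IsClique (s : Set (Fin n))) :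
    cliqueSubmatrix (hermRot θ C) s hs = imRot θ (cliqueSubmatrix C s hs) := by
  ext i j
  rw [cliqueSubmatrix, hermRot_apply]
  rfl

theorem cliqueSubmatrix_skewRot (θ : ℝ) (C : PartialMatrix G) (s : Finset (Fin n))
    (hs : G.IsClique (s : Set (Fin n))) :
    cliqueSubmatrix (skewRot θ C) s hs = -imRot θ (cliqueSubmatrix C s hs) := by
  rw [skewRot_eq_neg_hermRot, ← cliqueSubmatrix_hermRot]
  rfl

theorem imRot_isCompletion (θ : ℝ) {C : PartialMatrix G} {X : Matrix (Fin n) (Fin n) ℂ}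
    (hX : IsCompletion C X) : IsCompletion (hermRot θ C) (imRot θ X) := by
  intro p
  rw [hermRot_apply, ← hX p, ← hX ⟨(p.1.2, p.1.1), p.2.symm⟩]
  rfl

theorem neg_imRot_isCompletion (θ : ℝ) {C : PartialMatrix G} {X : Matrix (Fin n) (Fin n) ℂ}
    (hX : IsCompletion C X) : IsCompletion (skewRot θ C) (-imRot θ X) := by
  intro p
  rw [skewRot_eq_neg_hermRot, Matrix.neg_apply, imRot_isCompletion θ hX p]
  rfl

theorem phaseCombine_imRot (hs : Real.sin (β - α) ≠ 0) (X : Matrix (Fin n) (Fin n) ℂ) :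
    phaseCombine α β (imRot α X) (-imRot β X) = X := by
  ext i j
  exact phaseCombine_scalar hs (X i j) (Xᴴ i j)

theorem phaseCombine_isCompletion (hs : Real.sin (β - α) ≠ 0) {C : PartialMatrix G}
    {F₁ F₂ : Matrix (Fin n) (Fin n) ℂ} (h1 : IsCompletion (hermRot α C) F₁)
    (h2 : IsCompletion (skewRot β C) F₂) : IsCompletion C (phaseCombine α β F₁ F₂) := by
  intro p
  have h : phaseCombine α β F₁ F₂ p.1.1 p.1.2 = 1 / (Real.sin (β - α) : ℂ) *
      (Complex.exp (Complex.I * (β : ℂ)) * F₁ p.1.1 p.1.2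
        + Complex.exp (Complex.I * (α : ℂ)) * F₂ p.1.1 p.1.2) := rfl
  rw [h, h1 p, h2 p, skewRot_eq_neg_hermRot, Pi.neg_apply, hermRot_apply, hermRot_apply]
  exact phaseCombine_scalar hs _ _

/-- After rotation by $-\alpha$ the coefficient of $F_2$ is real and drops out, while that of $F_1$
has imaginary part $\sin(\beta-\alpha)$ before normalization; rotation by $-\beta$ exchanges the
roles, with a sign. -/
theorem imRot_phaseCombine (hs : Real.sin (β - α) ≠ 0) {F₁ F₂ : Matrix (Fin n) (Fin n) ℂ}
    (h1 : F₁.IsHermitian) (h2 : F₂.IsHermitian) :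
    imRot α (phaseCombine α β F₁ F₂) = F₁ ∧ -imRot β (phaseCombine α β F₁ F₂) = F₂ := by
  have hs' : (Real.sin (β - α) : ℂ) ≠ 0 := Complex.ofReal_ne_zero.mpr hs
  have hstar : (phaseCombine α β F₁ F₂)ᴴ = (1 / (Real.sin (β - α) : ℂ)) •
      (Complex.exp (-(Complex.I * (β : ℂ))) • F₁ + Complex.exp (-(Complex.I * (α : ℂ))) • F₂) := by
    rw [phaseCombine, Matrix.conjTranspose_smul, Matrix.conjTranspose_add,
      Matrix.conjTranspose_smul, Matrix.conjTranspose_smul, h1.eq, h2.eq, star_exp_I_mul,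
      star_exp_I_mul, star_div₀, star_one, Complex.star_def, Complex.conj_ofReal]
  have hsin := sin_sub_eq_exp α β
  generalize hσ : (Real.sin (β - α) : ℂ) = σ at hs' hsin hstar
  constructor
  · rw [imRot, hstar, phaseCombine, hσ]
    ext i j
    simp only [Matrix.smul_apply, Matrix.sub_apply, Matrix.add_apply, smul_eq_mul]
    generalize F₁ i j = x
    generalize F₂ i j = y
    generalize Complex.exp (Complex.I * (α : ℂ)) = u at *
    generalize Complex.exp (-(Complex.I * (α : ℂ))) = u' at *
    generalize Complex.exp (Complex.I * (β : ℂ)) = v at *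
    generalize Complex.exp (-(Complex.I * (β : ℂ))) = v' at *
    calc _ = 1 / σ * ((1 / (2 * Complex.I) * (v * u' - u * v')) * x) := by ring
      _ = x := by rw [← hsin, ← mul_assoc, one_div, inv_mul_cancel₀ hs', one_mul]
  · rw [imRot, hstar, phaseCombine, hσ]
    ext i j
    simp only [Matrix.neg_apply, Matrix.smul_apply, Matrix.sub_apply, Matrix.add_apply, smul_eq_mul]
    generalize F₁ i j = x
    generalize F₂ i j = y
    generalize Complex.exp (Complex.I * (α : ℂ)) = u at *
    generalize Complex.exp (-(Complex.I * (α : ℂ))) = u' at *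
    generalize Complex.exp (Complex.I * (β : ℂ)) = v at *
    generalize Complex.exp (-(Complex.I * (β : ℂ))) = v' at *
    calc _ = 1 / σ * ((1 / (2 * Complex.I) * (v * u' - u * v')) * y) := by ring
      _ = y := by rw [← hsin, ← mul_assoc, one_div, inv_mul_cancel₀ hs', one_mul]

theorem phaseCombine_bijOn (h₀ : 0 < β - α) (hπ : β - α < Real.pi) (C : PartialMatrix G) :
    Set.BijOn (fun F : Matrix (Fin n) (Fin n) ℂ × Matrix (Fin n) (Fin n) ℂ =>
        phaseCombine α β F.1 F.2)
      ({F | F.PosSemidef ∧ IsCompletion (hermRot α C) F} ×ˢ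
        {F | F.PosSemidef ∧ IsCompletion (skewRot β C) F})
      (completionSet α β C) := by
  have hs := (Real.sin_pos_of_pos_of_lt_pi h₀ hπ).ne'
  refine ⟨?_, ?_, ?_⟩
  · rintro ⟨F₁, F₂⟩ ⟨⟨hF₁, hc₁⟩, hF₂, hc₂⟩
    obtain ⟨e1, e2⟩ := imRot_phaseCombine hs hF₁.1 hF₂.1
    refine ⟨(mem_phaseBoundedCone_iff h₀ hπ).mpr ⟨?_, ?_⟩, phaseCombine_isCompletion hs hc₁ hc₂⟩
    · rwa [e1]
    · rwa [e2]
  · rintro ⟨F₁, F₂⟩ ⟨⟨hF₁, -⟩, hF₂, -⟩ ⟨F₁', F₂'⟩ ⟨⟨hF₁', -⟩, hF₂', -⟩ h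
    obtain ⟨e1, e2⟩ := imRot_phaseCombine hs hF₁.1 hF₂.1
    obtain ⟨e1', e2'⟩ := imRot_phaseCombine hs hF₁'.1 hF₂'.1
    have h : phaseCombine α β F₁ F₂ = phaseCombine α β F₁' F₂' := h
    exact Prod.ext (e1.symm.trans ((congrArg (imRot α) h).trans e1'))
      (e2.symm.trans ((congrArg (fun X => -imRot β X) h).trans e2'))
  · rintro X ⟨hX, hc⟩
    obtain ⟨h1, h2⟩ := (mem_phaseBoundedCone_iff h₀ hπ).mp hX
    exact ⟨(imRot α X, -imRot β X), ⟨⟨h1, imRot_isCompletion α hc⟩, h2, neg_imRot_isCompletion β hc⟩,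
      phaseCombine_imRot hs X⟩

end PhaseCombine


/-! ### Assembling the two semidefinite parametrizations -/

theorem bijOn_comp_prod {α₁ α₂ β₁ β₂ γ : Type*} {f₁ : α₁ → β₁} {f₂ : α₂ → β₂} {g : β₁ → β₂ → γ}
    {s₁ : Set α₁} {s₂ : Set α₂} {t₁ : Set β₁} {t₂ : Set β₂} {u : Set γ}
    (hg : Set.BijOn (fun p : β₁ × β₂ => g p.1 p.2) (t₁ ×ˢ t₂) u) (h₁ : Set.BijOn f₁ s₁ t₁)
    (h₂ : Set.BijOn f₂ s₂ t₂) :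
    Set.BijOn (fun p : α₁ × α₂ => g (f₁ p.1) (f₂ p.2)) (s₁ ×ˢ s₂) u :=
  hg.comp (h₁.prodMap h₂)

section Main

variable {n : ℕ} {G : SimpleGraph (Fin n)}

/-- The central completion is positive semidefinite, and its Cholesky factors parametrize all
positive semidefinite completions. -/
theorem centralCompletion_parametrization (hG : IsBanded G) {H : PartialMatrix G}
    (hH : ∀ i j (h : InPattern G i j), H ⟨(j, i), h.symm⟩ = star (H ⟨(i, j), h⟩))
    (hcl : ∀ (s : Finset (Fin n)) (hs : G.IsClique (s : Set (Fin n))),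
      (cliqueSubmatrix H s hs).PosSemidef) :
    (centralCompletion H).PosSemidef ∧
    ∀ R L W : Matrix (Fin n) (Fin n) ℂ, IsUpperCholesky (centralCompletion H) R →
      IsLowerCholesky (centralCompletion H) L → W ∈ Matrix.unitaryGroup (Fin n) ℂ → R = W * L →
      (∀ Γ ∈ gammaSet G R L, IsUnit (1 + W * Γ)) ∧
      Set.BijOn (psdParam R W) (gammaSet G R L) {F | F.PosSemidef ∧ IsCompletion H F} := by
  obtain ⟨U, hU⟩ := exists_adaptedBasis_centralCompletion hG hH hcl
  have hKc := centralCompletion_isCompletion hG H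
  constructor
  · obtain ⟨L, hL⟩ := hU.exists_lowerCholesky hG (centralCompletion_isHermitian hG hH) fun s hs => by
      rw [submatrix_eq_cliqueSubmatrix hKc s hs]
      exact hcl s hs
    rw [hL.2.1]
    exact Matrix.posSemidef_conjTranspose_mul_self L
  · intro R L W hR hL hW hRW
    exact ⟨fun Γ hΓ => (isUnit_one_add_of_mem_gammaSet hG hU hL hR hRW hΓ).2,
      psdParam_bijOn hG hKc hU hL hR (Matrix.mem_unitaryGroup_iff'.mp hW) hRW⟩

theorem exists_choleskyFactors {K : Matrix (Fin n) (Fin n) ℂ} (hK : K.PosSemidef) :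
    (∃ R, IsUpperCholesky K R) ∧ (∃ L, IsLowerCholesky K L) ∧
      ∀ R L, IsUpperCholesky K R → IsLowerCholesky K L →
        ∃ W ∈ Matrix.unitaryGroup (Fin n) ℂ, R = W * L :=
  ⟨exists_upperCholesky hK, exists_lowerCholesky hK, fun _ _ hR hL =>
    exists_unitary_mul_eq (hR.2.1.symm.trans hL.2.1)⟩

end Main

end PhaseCompletion

theorem mainTheorem4 {n : ℕ} (α β : ℝ) (h₀ : 0 < β - α) (hπ : β - α < Real.pi)
    (G : SimpleGraph (Fin n)) (hG : PhaseCompletion.IsBanded G)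
    (C : PhaseCompletion.PartialMatrix G)
    (hC : PhaseCompletion.IsPartiallyPhaseBounded α β C) :
    -- the set of completions is nonempty
    (PhaseCompletion.completionSet α β C).Nonempty ∧
    -- both central completions have Cholesky factors, and any two are related by a unitary matrix
    (∀ K : Matrix (Fin n) (Fin n) ℂ,
      (K = PhaseCompletion.centralCompletion (PhaseCompletion.hermRot α C) ∨
        K = PhaseCompletion.centralCompletion (PhaseCompletion.skewRot β C)) →
      (∃ R, PhaseCompletion.IsUpperCholesky K R) ∧
      (∃ L, PhaseCompletion.IsLowerCholesky K L) ∧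
      ∀ R L, PhaseCompletion.IsUpperCholesky K R → PhaseCompletion.IsLowerCholesky K L →
        ∃ W ∈ Matrix.unitaryGroup (Fin n) ℂ, R = W * L) ∧
    -- the one-to-one correspondence
    (∀ R₁ L₁ W₁ R₂ L₂ W₂ : Matrix (Fin n) (Fin n) ℂ,
      PhaseCompletion.IsUpperCholesky
        (PhaseCompletion.centralCompletion (PhaseCompletion.hermRot α C)) R₁ →
      PhaseCompletion.IsLowerCholesky
        (PhaseCompletion.centralCompletion (PhaseCompletion.hermRot α C)) L₁ →
      W₁ ∈ Matrix.unitaryGroup (Fin n) ℂ → R₁ = W₁ * L₁ →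
      PhaseCompletion.IsUpperCholesky
        (PhaseCompletion.centralCompletion (PhaseCompletion.skewRot β C)) R₂ →
      PhaseCompletion.IsLowerCholesky
        (PhaseCompletion.centralCompletion (PhaseCompletion.skewRot β C)) L₂ →
      W₂ ∈ Matrix.unitaryGroup (Fin n) ℂ → R₂ = W₂ * L₂ →
      (∀ Γ ∈ PhaseCompletion.gammaSet G R₁ L₁, IsUnit (1 + W₁ * Γ)) ∧
      (∀ Γ ∈ PhaseCompletion.gammaSet G R₂ L₂, IsUnit (1 + W₂ * Γ)) ∧
      Set.BijOn
        (fun Γ : Matrix (Fin n) (Fin n) ℂ × Matrix (Fin n) (Fin n) ℂ =>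
          PhaseCompletion.phaseCombine α β
            (PhaseCompletion.psdParam R₁ W₁ Γ.1) (PhaseCompletion.psdParam R₂ W₂ Γ.2))
        (PhaseCompletion.gammaSet G R₁ L₁ ×ˢ PhaseCompletion.gammaSet G R₂ L₂)
        (PhaseCompletion.completionSet α β C)) := by
  have hcl := fun s hs => (PhaseCompletion.mem_phaseBoundedCone_iff h₀ hπ).mp (hC s hs)
  obtain ⟨hK₁, hp₁⟩ := PhaseCompletion.centralCompletion_parametrization hG
    (PhaseCompletion.hermRot_symm α C) fun s hs => by
      rw [PhaseCompletion.cliqueSubmatrix_hermRot]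
      exact (hcl s hs).1
  obtain ⟨hK₂, hp₂⟩ := PhaseCompletion.centralCompletion_parametrization hG
    (PhaseCompletion.skewRot_symm β C) fun s hs => by
      rw [PhaseCompletion.cliqueSubmatrix_skewRot]
      exact (hcl s hs).2
  have hbij := PhaseCompletion.phaseCombine_bijOn h₀ hπ C
  -- The completion exhibited is the combination of the two central completions.
  refine ⟨⟨_, hbij.mapsTo (Set.mk_mem_prod
      ⟨hK₁, PhaseCompletion.centralCompletion_isCompletion hG _⟩
      ⟨hK₂, PhaseCompletion.centralCompletion_isCompletion hG _⟩)⟩, ?_, ?_⟩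
  · rintro K (rfl | rfl)
    · exact PhaseCompletion.exists_choleskyFactors hK₁
    · exact PhaseCompletion.exists_choleskyFactors hK₂
  · intro R₁ L₁ W₁ R₂ L₂ W₂ hR₁ hL₁ hW₁ hRW₁ hR₂ hL₂ hW₂ hRW₂
    obtain ⟨hu₁, hb₁⟩ := hp₁ R₁ L₁ W₁ hR₁ hL₁ hW₁ hRW₁
    obtain ⟨hu₂, hb₂⟩ := hp₂ R₂ L₂ W₂ hR₂ hL₂ hW₂ hRW₂
    exact ⟨hu₁, hu₂, PhaseCompletion.bijOn_comp_prod hbij hb₁ hb₂⟩
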